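/- A word is a finite sequence $w=w_1\dots w_m$ of positive integers. With $s_a=(a\;a{+}1)$, it is a reduced word of the permutation $s_{w_1}\cdots s_{w_m}$ if no shorter word has the same product. Write $w^{(i)}$ for $w$ with its $i$th letter removed. Edelman--Greene insertion. To insert $x$ into a row: if no entry of the row exceeds $x$, append $x$ at its end and stop. Otherwise let $y$ be the leftmost entry larger than $x$. If $y=x+1$ and the entry immediately before $y$ is $x$, leave the row unchanged and insert $x+1$ into the next row; in all other cases replace $y$ by $x$ and insert $y$ into the next row. Inserting into an empty row creates a box containing the inserted number. Inserting the letters $w_m,w_{m-1},\dots,w_1$ successively, starting with the empty tableau and always beginning at the first row, adds one box at each step. The recording tableau $Q(w)$ has entry $k$ in the box added at the $k$th step. Little bumps. Let $w$ be a reduced word and $i$ a position such that $w^{(i)}$ is reduced. To decrement a word $u$ at position $i$, replace $u_i$ by $u_i-1$ if $u_i>1$; if $u_i=1$, keep $u_i$ and increase every other letter by $1$. The letter $u_j$ of a word $u$ swaps the values $\sigma(u_j)$ and $\sigma(u_j+1)$, where $\sigma=s_{u_1}\cdots s_{u_{j-1}}$. The Little bump on $w$ begun at position $i$ is the following process: decrement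 the word at position $i$; if the result is reduced, stop; otherwise continue in the same way from a position $j\ne i$ whose letter swaps the same two values as the letter at position $i$. Theorem. Let $w$ be a reduced word and $i$ a position such that $w^{(i)}$ is reduced. Then the Little bump on $w$ begun at position $i$ is well defined (it ends in exactly one reduced word $w{\uparrow_i}$), and $$Q(w)=Q(w{\uparrow_i}).$$ -/

import Mathlib

namespace LittleEG

/-! ### Reduced words

A word is a list of positive integers; the letter `a` stands for the adjacent transposition
`s_a = (a a+1)`.  Permutations of `{1, ..., n}` are viewed as permutations of `ℕ` that fix every
other number, so that the symmetric groups are nested, and the words of `S_n` are those with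
letters in `{1, ..., n - 1}`. -/

/-- All letters are positive. -/
def IsWord (w : List ℕ) : Prop := ∀ a ∈ w, 1 ≤ a

/-- The permutation `s_{w_1} s_{w_2} ⋯ s_{w_m}`. -/
def wordPerm (w : List ℕ) : Equiv.Perm ℕ :=
  (w.map fun a => Equiv.swap a (a + 1)).prod

/-- `w` is a reduced word: it has minimal length among the words of the same permutation. -/
def IsReducedWord (w : List ℕ) : Prop :=
  IsWord w ∧ ∀ v : List ℕ, IsWord v → wordPerm v = wordPerm w → w.length ≤ v.length

/-! ### Edelman-Greene insertion

A tableau is the list of its rows, from top to bottom. -/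

/-- Insertion of `x` into the row `R`: the new row, and the entry (if any) that has to be inserted
into the next row.  The list `R.dropWhile (· ≤ x)` starts at the leftmost entry `y` of `R` that is
larger than `x`, and `R.takeWhile (· ≤ x)` holds the entries in front of `y`.  The bump is special
if `y = x + 1` and `y` is immediately preceded by `x`. -/
def rowInsert (x : ℕ) (R : List ℕ) : List ℕ × Option ℕ :=
  match R.dropWhile (· ≤ x) with
  | [] => (R ++ [x], none)
  | y :: ys =>
    if y = x + 1 ∧ (R.takeWhile (· ≤ x)).getLast? = some x then (R, some (x + 1))
    else (R.takeWhile (· ≤ x) ++ x :: ys, some y)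

/-- Insertion of `x` into a tableau: the new tableau, and the index (counted from `0`) of the row
at whose end the new box appears. -/
def tableauInsert (x : ℕ) : List (List ℕ) → List (List ℕ) × ℕ
  | [] => ([[x]], 0)
  | R :: T =>
    match rowInsert x R with
    | (R', none) => (R' :: T, 0)
    | (R', some y) => (R' :: (tableauInsert y T).1, (tableauInsert y T).2 + 1)

/-- Put the entry `k` in a new box at the end of row `r` (counted from `0`), where a new row is
started below the last one if `r` is the number of rows. -/
def addBox (k : ℕ) : List (List ℕ) → ℕ → List (List ℕ)
  | [], _ => [[k]]
  | R :: T, 0 => (R ++ [k]) :: T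
  | R :: T, r + 1 => R :: addBox k T r

/-- The insertion tableau `P(w)`: the letters of `w` are inserted from right to left. -/
def insertionTableau : List ℕ → List (List ℕ)
  | [] => []
  | a :: w => (tableauInsert a (insertionTableau w)).1

/-- The recording tableau `Q(w)`: the box added in the `k`-th insertion gets the entry `k`. -/
def recordingTableau : List ℕ → List (List ℕ)
  | [] => []
  | a :: w =>
    addBox (w.length + 1) (recordingTableau w) (tableauInsert a (insertionTableau w)).2

/-! ### Little bumps

Positions in a word are counted from `0`, so `w.eraseIdx i` is `w` without its letter at `i`. -/

/-- Decrement the letter at position `i`, or, if that letter is `1`, keep it and increment every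
other letter. -/
def decrementAt (w : List ℕ) (i : ℕ) : List ℕ :=
  if w[i]? = some 1 then (w.map (· + 1)).set i 1 else w.modify i (· - 1)

/-- The pair of values that the letter at position `i < w.length` swaps: with `σ` the permutation of
the letters in front of position `i`, and `a` the letter at position `i`, right multiplication by
`s_a` exchanges the values `σ(a)` and `σ(a + 1)` in the one-line notation of `σ`. -/
def swappedValues (w : List ℕ) (i : ℕ) : Sym2 ℕ :=
  s(wordPerm (w.take i) (w.getD i 0), wordPerm (w.take i) (w.getD i 0 + 1))

/-- `BumpsTo w i v`: the process that starts by decrementing position `i` of `w` ends with the word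
`v`.  After each decrementation at a position `i`, the process ends if the word is reduced, and
otherwise it goes on at another position `j` whose letter swaps the same values as the letter
at `i`. -/
inductive BumpsTo : List ℕ → ℕ → List ℕ → Prop
  | last (w : List ℕ) (i : ℕ) (h : IsReducedWord (decrementAt w i)) :
      BumpsTo w i (decrementAt w i)
  | next (w : List ℕ) (i j : ℕ) (v : List ℕ)
      (h : ¬ IsReducedWord (decrementAt w i)) (hj : j < w.length) (hij : j ≠ i)
      (hs : swappedValues (decrementAt w i) j = swappedValues (decrementAt w i) i)
      (hv : BumpsTo (decrementAt w i) j v) : BumpsTo w i v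

end LittleEG

/-!
The recording tableau of a word is determined by the shapes of the insertion tableaux of its
suffixes, and the proof computes these shapes from data that a Little bump does not change.

*The process.*  A letter of a word swaps two values; the transposition of these values is the
`crossing` of the letter.  If deleting the letter at `i` leaves a reduced word but the word itself is
not reduced, then exactly one other letter has the same crossing (`exists_conflict`,
`conflict_unique`), so the bump never has a choice.  All words that occur, with the letter
decremented last deleted, are reduced words of one and the same permutation; their letters are
therefore bounded below (`Red.le_of_mem`), while the sum of the letters decreases, so the bump ends
(`exists_bump`).  For this it is convenient to let the letters be arbitrary integers and always to
decrement; the actual process on positive words agrees with this one up to translations.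

*Invariance.*  A bump preserves the positions of the descents (`BumpRel.lt_iff`) and commutes with
the Coxeter-Knuth move made at three consecutive letters `x < y > z` (`BumpRel.ck`).  For the latter
the two processes run in parallel: a letter of the window `x y z` corresponds to the letter with the
same crossing in the window after the move (`crossing_ck`), and whenever the processes enter the
window, each needs at most two steps until the windows are again related by a Coxeter-Knuth move
(`window_step`).

*Insertion.*  Let `R` be an increasing row and `a` a letter, and read rows from right to left.  If the
word `a R` has an ascent at its first place, then row insertion is the sequence of Coxeter-Knuth
moves at the first three letters, at the letters two to four, and so on: they lead to the new row
followed by the bumped entry (`rowInsert_eq_sweep`).  If there is a descent, `a` is appended to the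
row, and the word stays the same.  Hence the descents decide which moves at which positions turn a
word, suffix by suffix, into reading words of insertion tableaux, and they decide the shapes too.  By
induction all this is the same for a word and for its bump (`BumpRel.tableauInsert`), so that the
recording tableaux agree.
-/

namespace LittleEG

/-! ### Words in the integers, crossings and reducedness -/

/-- The adjacent transposition `s_a = (a a+1)` of `ℤ`. -/
def adjSwap (a : ℤ) : Equiv.Perm ℤ := Equiv.swap a (a + 1)

/-- The permutation of `ℤ` that a word with arbitrary integer letters stands for. -/
def intPerm (w : List ℤ) : Equiv.Perm ℤ := (w.map adjSwap).prod

/-- The reflection `σ s_a σ⁻¹`, where `a` is the letter of `w` at position `i` and `σ` is the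
permutation of the letters in front of it.  It is the transposition of the two values that the
letter swaps. -/
def crossing (w : List ℤ) (i : ℕ) : Equiv.Perm ℤ :=
  intPerm (w.take i) * adjSwap (w.getD i 0) * (intPerm (w.take i))⁻¹

/-- `w` has minimal length among the integer words of its permutation. -/
def Red (w : List ℤ) : Prop := ∀ v : List ℤ, intPerm v = intPerm w → w.length ≤ v.length

@[simp] theorem adjSwap_mul_self (a : ℤ) : adjSwap a * adjSwap a = 1 := Equiv.swap_mul_self _ _

@[simp] theorem adjSwap_mul_self_mul (a : ℤ) (σ : Equiv.Perm ℤ) :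
    adjSwap a * (adjSwap a * σ) = σ := by rw [← mul_assoc, adjSwap_mul_self, one_mul]

@[simp] theorem adjSwap_inv (a : ℤ) : (adjSwap a)⁻¹ = adjSwap a := Equiv.swap_inv _ _

theorem adjSwap_comm {a c : ℤ} (h : a + 2 ≤ c ∨ c + 2 ≤ a) :
    adjSwap a * adjSwap c = adjSwap c * adjSwap a := by
  ext x
  simp only [adjSwap, Equiv.Perm.mul_apply, Equiv.swap_apply_def]
  split_ifs <;> omega

theorem adjSwap_braid (a : ℤ) :
    adjSwap a * (adjSwap (a + 1) * adjSwap a) =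
      adjSwap (a + 1) * (adjSwap a * adjSwap (a + 1)) := by
  ext x
  simp only [adjSwap, Equiv.Perm.mul_apply, Equiv.swap_apply_def]
  split_ifs <;> omega

@[simp] theorem intPerm_nil : intPerm [] = 1 := rfl

@[simp] theorem intPerm_cons (a : ℤ) (w : List ℤ) : intPerm (a :: w) = adjSwap a * intPerm w := by
  simp [intPerm]

@[simp] theorem intPerm_append (v w : List ℤ) : intPerm (v ++ w) = intPerm v * intPerm w := by
  simp [intPerm]

@[simp] theorem crossing_cons_zero (a : ℤ) (w : List ℤ) : crossing (a :: w) 0 = adjSwap a := by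
  simp [crossing]

@[simp] theorem crossing_cons_succ (a : ℤ) (w : List ℤ) (i : ℕ) :
    crossing (a :: w) (i + 1) = adjSwap a * crossing w i * adjSwap a := by
  simp [crossing, mul_assoc]

theorem crossing_append_left {p : List ℤ} {i : ℕ} (t : List ℤ) (h : i < p.length) :
    crossing (p ++ t) i = crossing p i := by
  simp [crossing, List.take_append_of_le_length h.le, List.getElem?_append_left h]

theorem crossing_append_right (p t : List ℤ) (k : ℕ) :
    crossing (p ++ t) (p.length + k) = intPerm p * crossing t k * (intPerm p)⁻¹ := by
  induction p with
  | nil => simp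
  | cons a p ih =>
    rw [List.cons_append, List.length_cons, Nat.add_right_comm, crossing_cons_succ, ih]
    simp [mul_assoc]

theorem crossing_append_length (p t : List ℤ) :
    crossing (p ++ t) p.length = intPerm p * crossing t 0 * (intPerm p)⁻¹ :=
  crossing_append_right p t 0

theorem crossing_mul_self (w : List ℤ) (i : ℕ) : crossing w i * crossing w i = 1 := by
  simp [crossing, mul_assoc]

theorem intPerm_eraseIdx {w : List ℤ} {i : ℕ} (h : i < w.length) :
    intPerm (w.eraseIdx i) = crossing w i * intPerm w := by
  induction w generalizing i with
  | nil => simp at h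
  | cons a w ih =>
    cases i with
    | zero => simp
    | succ i => simp [ih (by simpa using h), mul_assoc]

theorem crossing_eraseIdx_of_lt (w : List ℤ) {i j : ℕ} (h : j < i) :
    crossing (w.eraseIdx i) j = crossing w j := by
  induction w generalizing i j with
  | nil => simp
  | cons a w ih =>
    cases i with
    | zero => omega
    | succ i =>
      cases j with
      | zero => simp
      | succ j => simp [ih (show j < i by omega)]

theorem crossing_eraseIdx_of_le {w : List ℤ} {i j : ℕ} (h : i ≤ j) (hi : i < w.length) :
    crossing (w.eraseIdx i) j = crossing w i * crossing w (j + 1) * crossing w i := by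
  induction w generalizing i j with
  | nil => simp at hi
  | cons a w ih =>
    cases i with
    | zero => simp [mul_assoc]
    | succ i =>
      cases j with
      | zero => omega
      | succ j => simp [ih (show i ≤ j by omega) (by simpa using hi), mul_assoc]

/-- Two values whose order is reversed by the permutation of `w` are swapped by some letter. -/
theorem exists_crossing_eq_swap {w : List ℤ} {p q : ℤ} (hpq : p < q)
    (h : (intPerm w)⁻¹ q < (intPerm w)⁻¹ p) :
    ∃ j < w.length, crossing w j = Equiv.swap p q := by
  induction w generalizing p q with
  | nil => simp at h; omega
  | cons a w ih =>
    by_cases hap : p = a ∧ q = a + 1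
    · exact ⟨0, by simp, by simp [adjSwap, hap.1, hap.2]⟩
    · have hlt : adjSwap a p < adjSwap a q := by
        simp only [adjSwap, Equiv.swap_apply_def]
        split_ifs <;> omega
      obtain ⟨j, hj, hc⟩ := ih hlt (by simpa using h)
      refine ⟨j + 1, by simpa using hj, ?_⟩
      rw [crossing_cons_succ, hc, Equiv.swap_apply_apply]
      simp [mul_assoc]

theorem exists_crossing_form (w : List ℤ) (i : ℕ) :
    ∃ p q : ℤ, p < q ∧ crossing w i = Equiv.swap p q := by
  set σ := intPerm (w.take i)
  set a := w.getD i 0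
  have h : crossing w i = Equiv.swap (σ a) (σ (a + 1)) := by
    rw [Equiv.swap_apply_apply]; rfl
  rcases lt_trichotomy (σ a) (σ (a + 1)) with hlt | heq | hgt
  · exact ⟨_, _, hlt, h⟩
  · have := σ.injective heq
    omega
  · exact ⟨_, _, hgt, by rw [h, Equiv.swap_comm]⟩

theorem Red.of_intPerm_eq {v w : List ℤ} (hw : Red w) (h : intPerm v = intPerm w)
    (hl : v.length = w.length) : Red v :=
  fun u hu => hl ▸ hw u (hu.trans h)

theorem not_red_of_intPerm_eq {v w : List ℤ} (h : intPerm v = intPerm w)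
    (hl : v.length < w.length) : ¬ Red w :=
  fun hw => (hw v h).not_gt hl

/-- Two letters that swap the same values can both be deleted. -/
theorem intPerm_eraseIdx_eraseIdx {w : List ℤ} {i j : ℕ} (hi : i < w.length) (hij : j < i)
    (h : crossing w i = crossing w j) : intPerm ((w.eraseIdx i).eraseIdx j) = intPerm w := by
  have hl : (w.eraseIdx i).length = w.length - 1 := List.length_eraseIdx_of_lt hi
  rw [intPerm_eraseIdx (by omega), crossing_eraseIdx_of_lt w hij, intPerm_eraseIdx hi, ← h,
    ← mul_assoc, crossing_mul_self, one_mul]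

/-- No two letters of a reduced word swap the same values. -/
theorem Red.crossing_injective {w : List ℤ} (hw : Red w) {i j : ℕ} (hi : i < w.length)
    (hj : j < w.length) (h : crossing w i = crossing w j) : i = j := by
  wlog hij : j < i generalizing i j
  · rcases (not_lt.mp hij).eq_or_lt with h' | h'
    · exact h'
    · exact (this hj hi h.symm h').symm
  refine absurd hw (not_red_of_intPerm_eq (intPerm_eraseIdx_eraseIdx hi hij h) ?_)
  have hl : (w.eraseIdx i).length = w.length - 1 := List.length_eraseIdx_of_lt hi
  rw [List.length_eraseIdx_of_lt (by omega)]
  omega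

/-- The position in `w.eraseIdx i` of the letter at position `j ≠ i` of `w`. -/
def erasedPos (i j : ℕ) : ℕ := if j < i then j else j - 1

theorem crossing_erasedPos {w : List ℤ} {i j : ℕ} (hi : i < w.length) (hij : j ≠ i)
    (h : crossing w j = crossing w i) :
    crossing (w.eraseIdx i) (erasedPos i j) = crossing w i := by
  unfold erasedPos
  split_ifs with hlt
  · rw [crossing_eraseIdx_of_lt w hlt, h]
  · obtain ⟨k, rfl⟩ : ∃ k, j = k + 1 := ⟨j - 1, by omega⟩
    rw [Nat.add_sub_cancel, crossing_eraseIdx_of_le (by omega) hi, h, crossing_mul_self, one_mul]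

/-- At most one other letter swaps the same values as a letter whose deletion leaves a reduced
word. -/
theorem conflict_unique {w : List ℤ} {i j k : ℕ} (hi : i < w.length) (hw : Red (w.eraseIdx i))
    (hj : j < w.length) (hij : j ≠ i) (hcj : crossing w j = crossing w i)
    (hk : k < w.length) (hik : k ≠ i) (hck : crossing w k = crossing w i) : j = k := by
  have hl : (w.eraseIdx i).length = w.length - 1 := List.length_eraseIdx_of_lt hi
  have := hw.crossing_injective (i := erasedPos i j) (j := erasedPos i k)
    (by unfold erasedPos; split_ifs <;> omega) (by unfold erasedPos; split_ifs <;> omega)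
    ((crossing_erasedPos hi hij hcj).trans (crossing_erasedPos hi hik hck).symm)
  unfold erasedPos at this
  split_ifs at this <;> omega

/-- Exchange property: if `w` is not reduced but loses this defect with its letter at `i`, then
another letter swaps the same values as that letter. -/
theorem exists_conflict {w : List ℤ} {i : ℕ} (hi : i < w.length) (hw : Red (w.eraseIdx i))
    (hn : ¬ Red w) : ∃ j < w.length, j ≠ i ∧ crossing w j = crossing w i := by
  have hl : (w.eraseIdx i).length = w.length - 1 := List.length_eraseIdx_of_lt hi
  obtain ⟨p, q, hpq, hc⟩ := exists_crossing_form w i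
  have hτ := intPerm_eraseIdx hi
  by_cases hinv : (intPerm (w.eraseIdx i))⁻¹ q < (intPerm (w.eraseIdx i))⁻¹ p
  · obtain ⟨j, hj, hcj⟩ := exists_crossing_eq_swap hpq hinv
    rw [← hc] at hcj
    rcases lt_or_ge j i with hji | hij
    · exact ⟨j, by omega, by omega, by rwa [crossing_eraseIdx_of_lt w hji] at hcj⟩
    · refine ⟨j + 1, by omega, by omega, ?_⟩
      rw [crossing_eraseIdx_of_le hij hi] at hcj
      have h2 := crossing_mul_self w i
      have h3 : crossing w (j + 1) * crossing w i = 1 :=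
        mul_left_cancel (a := crossing w i) (by rw [← mul_assoc, hcj, mul_one])
      exact mul_right_cancel (h3.trans h2.symm)
  · -- The values are swapped in `w`, hence also in a shorter word `v` of the same permutation;
    -- deleting that letter of `v` contradicts the reducedness of `w.eraseIdx i`.
    exfalso
    simp only [Red, not_forall, not_le] at hn
    obtain ⟨v, hv, hvl⟩ := hn
    have hne : (intPerm (w.eraseIdx i))⁻¹ q ≠ (intPerm (w.eraseIdx i))⁻¹ p :=
      fun h => hpq.ne' ((intPerm (w.eraseIdx i))⁻¹.injective h)
    rw [hτ, hc, mul_inv_rev, Equiv.swap_inv, Equiv.Perm.mul_apply, Equiv.Perm.mul_apply,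
      Equiv.swap_apply_left, Equiv.swap_apply_right, ← hv] at hinv hne
    obtain ⟨j, hj, hcj⟩ := exists_crossing_eq_swap hpq (lt_of_le_of_ne (not_lt.mp hinv) hne.symm)
    have := hw (v.eraseIdx j) (by rw [intPerm_eraseIdx hj, hcj, hτ, hc, hv])
    rw [List.length_eraseIdx_of_lt hj] at this
    omega

/-- Deletion property. -/
theorem exists_crossing_eq_of_not_red {w : List ℤ} (h : ¬ Red w) :
    ∃ i < w.length, ∃ j < i, crossing w i = crossing w j := by
  induction w with
  | nil => exact absurd (fun v _ => by simp) h
  | cons a w ih =>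
    by_cases hw : Red w
    · obtain ⟨j, hj, hj0, hc⟩ := exists_conflict (w := a :: w) (i := 0) (by simp) (by simpa) h
      exact ⟨j, hj, 0, by omega, hc⟩
    · obtain ⟨i, hi, j, hj, hc⟩ := ih hw
      exact ⟨i + 1, by simpa using hi, j + 1, by omega, by simp [hc]⟩

/-- The values swapped by a letter of a reduced word end up in reversed order. -/
theorem Red.inverted {w : List ℤ} (hw : Red w) {i : ℕ} (hi : i < w.length) {p q : ℤ} (hpq : p < q)
    (hc : crossing w i = Equiv.swap p q) : (intPerm w)⁻¹ q < (intPerm w)⁻¹ p := by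
  by_contra hinv
  have hne : (intPerm w)⁻¹ q ≠ (intPerm w)⁻¹ p :=
    fun h => hpq.ne' ((intPerm w)⁻¹.injective h)
  have hτ := intPerm_eraseIdx hi
  rw [hc] at hτ
  obtain ⟨j, hj, hcj⟩ := exists_crossing_eq_swap (w := w.eraseIdx i) hpq (by
    rw [hτ, mul_inv_rev, Equiv.swap_inv, Equiv.Perm.mul_apply, Equiv.Perm.mul_apply,
      Equiv.swap_apply_left, Equiv.swap_apply_right]
    omega)
  have := hw ((w.eraseIdx i).eraseIdx j) (by
    rw [intPerm_eraseIdx hj, hcj, hτ, ← mul_assoc, Equiv.swap_mul_self, one_mul])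
  rw [List.length_eraseIdx_of_lt hj, List.length_eraseIdx_of_lt hi] at this
  omega

theorem intPerm_apply_of_lt {w : List ℤ} {L : ℤ} (hw : ∀ a ∈ w, L ≤ a) {x : ℤ} (hx : x < L) :
    intPerm w x = x := by
  induction w with
  | nil => rfl
  | cons a w ih =>
    have ha : L ≤ a := hw a (by simp)
    rw [intPerm_cons, Equiv.Perm.mul_apply, ih fun b hb => hw b (by simp [hb]), adjSwap,
      Equiv.swap_apply_of_ne_of_ne] <;> omega

/-- The letters of a reduced word are bounded below in terms of its permutation: the least letter
is not fixed. -/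
theorem Red.le_of_mem {w : List ℤ} (hw : Red w) {L : ℤ} (hL : ∀ x < L, intPerm w x = x) :
    ∀ a ∈ w, L ≤ a := by
  by_contra! hex
  obtain ⟨b, hb, hbL⟩ := hex
  obtain ⟨a, ha, hmin⟩ := w.toFinset.exists_min_image id ⟨b, by simpa using hb⟩
  simp only [List.mem_toFinset, id] at ha hmin
  have haL : a < L := (hmin b hb).trans_lt hbL
  obtain ⟨p, s, rfl, hap⟩ := List.eq_append_cons_of_mem ha
  -- The first letter `a` swaps the value `a` with a larger one.
  have hpa : intPerm p a = a := intPerm_apply_of_lt (L := a + 1) (fun c hc => by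
    have := hmin c (by simp [hc])
    have : c ≠ a := fun h => hap (h ▸ hc)
    omega) (by omega)
  have hge : ∀ v : List ℤ, (∀ c ∈ v, a ≤ c) → ∀ x, a ≤ x → a ≤ (intPerm v)⁻¹ x := by
    intro v hv x hx
    by_contra hlt
    have := intPerm_apply_of_lt hv (not_le.mp hlt)
    have hx' : intPerm v ((intPerm v)⁻¹ x) = x := by simp
    omega
  have hgt : a < intPerm p (a + 1) := by
    by_contra hle
    have h1 : intPerm p (a + 1) ≠ a := fun h => by
      have := (intPerm p).injective (h.trans hpa.symm); omega
    have h2 := intPerm_apply_of_lt (w := p) (L := a) (fun c hc => hmin c (by simp [hc]))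
      (x := intPerm p (a + 1)) (by omega)
    have := (intPerm p).injective h2
    omega
  have hc : crossing (p ++ a :: s) p.length = Equiv.swap a (intPerm p (a + 1)) := by
    rw [crossing_append_length, crossing_cons_zero, adjSwap, ← Equiv.swap_apply_apply, hpa]
  have hinv := hw.inverted (by simp) hgt hc
  have hfix : (intPerm (p ++ a :: s))⁻¹ a = a := by
    rw [Equiv.Perm.inv_eq_iff_eq]; exact (hL a haL).symm
  rw [hfix] at hinv
  exact hinv.not_ge (hge _ hmin _ hgt.le)

/-! ### The bumping process on integer words -/

/-- Decrement the letter at position `i`. -/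
def dec (w : List ℤ) (i : ℕ) : List ℤ := w.modify i (· - 1)

@[simp] theorem length_dec (w : List ℤ) (i : ℕ) : (dec w i).length = w.length := by simp [dec]

theorem dec_append_left {p : List ℤ} {i : ℕ} (t : List ℤ) (h : i < p.length) :
    dec (p ++ t) i = dec p i ++ t := by
  induction p generalizing i with
  | nil => simp at h
  | cons a p ih =>
    cases i with
    | zero => simp [dec]
    | succ i =>
      have := ih (i := i) (by simpa using h)
      simp only [dec] at this
      simp [dec, this]

theorem dec_append_right (p t : List ℤ) (k : ℕ) : dec (p ++ t) (p.length + k) = p ++ dec t k := by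
  induction p with
  | nil => simp
  | cons a p ih =>
    simp only [dec] at ih
    simp [dec, Nat.add_right_comm p.length 1 k, ih]

@[simp] theorem dec_cons_zero (a : ℤ) (w : List ℤ) : dec (a :: w) 0 = (a - 1) :: w := by simp [dec]

@[simp] theorem dec_cons_succ (a : ℤ) (w : List ℤ) (i : ℕ) :
    dec (a :: w) (i + 1) = a :: dec w i := by simp [dec]

theorem eraseIdx_dec (w : List ℤ) (i : ℕ) : (dec w i).eraseIdx i = w.eraseIdx i := by
  induction w generalizing i with
  | nil => simp [dec]
  | cons a w ih =>
    cases i with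
    | zero => simp
    | succ i => simp [ih]

/-- `Bump n u i v`: the word `u`, whose letter at position `i` has just been decremented, is turned
into the reduced word `v` by `n` further decrementations. -/
inductive Bump : ℕ → List ℤ → ℕ → List ℤ → Prop
  | done (u : List ℤ) (i : ℕ) (h : Red u) : Bump 0 u i u
  | next (n : ℕ) (u : List ℤ) (i j : ℕ) (v : List ℤ) (h : ¬ Red u) (hj : j < u.length)
      (hij : j ≠ i) (hc : crossing u j = crossing u i) (hv : Bump n (dec u j) j v) :
      Bump (n + 1) u i v

theorem Bump.red {n : ℕ} {u : List ℤ} {i : ℕ} {v : List ℤ} (h : Bump n u i v) : Red v := by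
  induction h with
  | done _ _ h => exact h
  | next _ _ _ _ _ _ _ _ _ _ ih => exact ih

theorem Bump.length_eq {n : ℕ} {u : List ℤ} {i : ℕ} {v : List ℤ} (h : Bump n u i v) :
    v.length = u.length := by
  induction h with
  | done _ _ h => rfl
  | next _ _ _ _ _ _ _ _ _ _ ih => simpa using ih

/-- Passing to the conflicting letter does not change the permutation of the remaining letters. -/
theorem intPerm_eraseIdx_congr {u : List ℤ} {i j : ℕ} (hi : i < u.length) (hj : j < u.length)
    (hc : crossing u j = crossing u i) :
    intPerm (u.eraseIdx j) = intPerm (u.eraseIdx i) := by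
  rw [intPerm_eraseIdx hj, intPerm_eraseIdx hi, hc]

theorem Red.eraseIdx_congr {u : List ℤ} {i j : ℕ} (hi : i < u.length) (hu : Red (u.eraseIdx i))
    (hj : j < u.length) (hc : crossing u j = crossing u i) : Red (u.eraseIdx j) :=
  hu.of_intPerm_eq (intPerm_eraseIdx_congr hi hj hc)
    (by rw [List.length_eraseIdx_of_lt hi, List.length_eraseIdx_of_lt hj])

/-- In a word that is not reduced, the process continues at the given conflicting letter. -/
theorem Bump.forced {n : ℕ} {u v : List ℤ} {i : ℕ} (h : Bump n u i v) (hi : i < u.length)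
    (hu : Red (u.eraseIdx i)) (hn : ¬ Red u) {j : ℕ} (hj : j < u.length) (hij : j ≠ i)
    (hc : crossing u j = crossing u i) : ∃ m < n, Bump m (dec u j) j v := by
  cases h with
  | done _ _ h => exact absurd h hn
  | next n _ _ k _ _ hk hik hck hv =>
    obtain rfl := conflict_unique hi hu hj hij hc hk hik hck
    exact ⟨n, by omega, hv⟩

theorem sum_dec {u : List ℤ} {j : ℕ} (hj : j < u.length) : (dec u j).sum = u.sum - 1 := by
  induction u generalizing j with
  | nil => simp at hj
  | cons a u ih =>
    cases j with
    | zero => simp; ring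
    | succ j => simp [ih (by simpa using hj)]; ring

theorem mem_eraseIdx_or_eq {u : List ℤ} {i : ℕ} {a : ℤ} (ha : a ∈ u) :
    a ∈ u.eraseIdx i ∨ u[i]? = some a := by
  induction u generalizing i with
  | nil => simp at ha
  | cons b u ih =>
    cases i with
    | zero => simp at ha ⊢; tauto
    | succ i =>
      have := @ih i
      simp at ha ⊢; tauto

theorem sum_lower_bound {u : List ℤ} {M : ℤ} (h : ∀ a ∈ u, M ≤ a) : u.length * M ≤ u.sum := by
  induction u with
  | nil => simp
  | cons a u ih =>
    have := ih fun b hb => h b (by simp [hb])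
    have := h a (by simp)
    simp; linarith

/-- The process ends: the words `u.eraseIdx i` that occur are reduced words of one permutation, so
that all letters stay bounded below, while their sum decreases. -/
theorem exists_bump {u : List ℤ} {i : ℕ} (hi : i < u.length) (hu : Red (u.eraseIdx i)) :
    ∃ n v, Bump n u i v := by
  obtain ⟨L, hL⟩ : ∃ L : ℤ, ∀ a ∈ u, L ≤ a := by
    obtain ⟨L, hL⟩ := u.toFinset.bddBelow
    exact ⟨L, fun a ha => hL (by simpa using ha)⟩
  have hfix : ∀ x < L, intPerm (u.eraseIdx i) x = x := fun x hx =>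
    intPerm_apply_of_lt (fun a ha => hL a (List.mem_of_mem_eraseIdx ha)) hx
  have hLi : ∀ a, u[i]? = some a → L - 1 ≤ a := fun a ha => by
    have := hL a (List.mem_of_getElem? ha); omega
  clear hL
  obtain ⟨N, hN⟩ : ∃ N : ℕ, (u.sum - u.length * (L - 1)).toNat ≤ N := ⟨_, le_rfl⟩
  induction N using Nat.strong_induction_on generalizing u i with
  | _ N IH =>
    by_cases hr : Red u
    · exact ⟨0, u, .done u i hr⟩
    obtain ⟨j, hj, hij, hc⟩ := exists_conflict hi hu hr
    have hp := intPerm_eraseIdx_congr hi hj hc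
    have hu' := Red.eraseIdx_congr hi hu hj hc
    have hlow : ∀ a ∈ u, L - 1 ≤ a := fun a ha => by
      rcases mem_eraseIdx_or_eq (i := i) ha with h | h
      · have := hu.le_of_mem hfix a h; omega
      · exact hLi a h
    have hj' : ∀ a, (dec u j)[j]? = some a → L - 1 ≤ a := by
      intro a ha
      have hmem : u[j] ∈ u.eraseIdx i := by
        rw [List.mem_eraseIdx_iff_getElem]
        exact ⟨j, hj, hij, rfl⟩
      have := hu.le_of_mem hfix _ hmem
      simp [dec, hj] at ha
      omega
    have hlow' : ∀ a ∈ dec u j, L - 1 ≤ a := fun a ha => by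
      rcases mem_eraseIdx_or_eq (i := j) ha with h | h
      · rw [eraseIdx_dec] at h
        exact hlow a (List.mem_of_mem_eraseIdx h)
      · exact hj' a h
    have h1 := sum_lower_bound hlow'
    have h2 := sum_dec hj
    simp only [length_dec] at h1
    obtain ⟨n, v, hv⟩ := IH ((dec u j).sum - (dec u j).length * (L - 1)).toNat
      (by rw [length_dec]; omega) (u := dec u j) (i := j) (by simpa using hj)
      (by rwa [eraseIdx_dec]) (by rw [eraseIdx_dec, hp]; exact hfix) hj' le_rfl
    exact ⟨n + 1, v, .next n u i j v hr hj hij hc hv⟩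

/-! ### Bumps preserve ascents and descents -/

theorem dec_length (p t : List ℤ) (x : ℤ) : dec (p ++ x :: t) p.length = p ++ (x - 1) :: t := by
  simpa using dec_append_right p (x :: t) 0

theorem dec_length_add_one (p t : List ℤ) (x y : ℤ) :
    dec (p ++ x :: y :: t) (p.length + 1) = p ++ x :: (y - 1) :: t := by
  simpa using dec_append_right p (x :: y :: t) 1

theorem dec_length_add_two (p t : List ℤ) (x y z : ℤ) :
    dec (p ++ x :: y :: z :: t) (p.length + 2) = p ++ x :: y :: (z - 1) :: t := by
  simpa using dec_append_right p (x :: y :: z :: t) 2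

theorem not_red_pair (p s : List ℤ) (a : ℤ) : ¬ Red (p ++ a :: a :: s) :=
  not_red_of_intPerm_eq (v := p ++ s) (by simp) (by simp)

theorem crossing_pair (p s : List ℤ) (a : ℤ) :
    crossing (p ++ a :: a :: s) p.length = crossing (p ++ a :: a :: s) (p.length + 1) := by
  rw [crossing_append_length, crossing_append_right]
  simp [mul_assoc]

theorem not_red_sandwich (p s : List ℤ) {a c : ℤ} (h : a + 2 ≤ c ∨ c + 2 ≤ a) :
    ¬ Red (p ++ a :: c :: a :: s) :=
  not_red_of_intPerm_eq (v := p ++ c :: s)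
    (by
      have h' : adjSwap a * (adjSwap c * (adjSwap a * intPerm s)) = adjSwap c * intPerm s := by
        rw [← mul_assoc (adjSwap c), ← adjSwap_comm h, mul_assoc, adjSwap_mul_self_mul]
      simp [h']) (by simp)

theorem crossing_sandwich (p s : List ℤ) {a c : ℤ} (h : a + 2 ≤ c ∨ c + 2 ≤ a) :
    crossing (p ++ a :: c :: a :: s) p.length =
      crossing (p ++ a :: c :: a :: s) (p.length + 2) := by
  rw [crossing_append_length, crossing_append_right]
  simp only [crossing_cons_zero, crossing_cons_succ]
  rw [mul_assoc (adjSwap c), adjSwap_comm h, adjSwap_mul_self_mul, adjSwap_mul_self, one_mul]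

theorem dec_ascent (p s : List ℤ) {x y : ℤ} (hxy : x < y) (j : ℕ) :
    ∃ p' x' y' s', dec (p ++ x :: y :: s) j = p' ++ x' :: y' :: s' ∧ p'.length = p.length ∧
      (x' < y' ∨ x' = y' ∧ j = p.length + 1) := by
  rcases lt_or_ge j p.length with hjp | hjp
  · exact ⟨dec p j, x, y, s, dec_append_left _ hjp, by simp, .inl hxy⟩
  · obtain ⟨k, rfl⟩ := Nat.exists_eq_add_of_le hjp
    rcases k with _ | _ | k <;> rw [dec_append_right] <;>
      simp only [dec_cons_zero, dec_cons_succ, and_true] <;> refine ⟨p, _, _, _, rfl, rfl, ?_⟩ <;> omega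

/-- An ascent at two given positions persists.  After its right letter was decremented to equal the
left one, the conflicting letter is the left one, so that the ascent is restored in the next
step. -/
theorem Bump.ascent {n : ℕ} {p s : List ℤ} {x y : ℤ} {i : ℕ} {v : List ℤ}
    (hb : Bump n (p ++ x :: y :: s) i v) (hi : i < (p ++ x :: y :: s).length)
    (hr : Red ((p ++ x :: y :: s).eraseIdx i)) (hxy : x < y ∨ x = y ∧ i = p.length + 1) :
    ∃ p' x' y' s', v = p' ++ x' :: y' :: s' ∧ p'.length = p.length ∧ x' < y' := by
  induction n generalizing p x y s i with
  | zero =>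
    cases hb with
    | done _ _ h =>
      rcases hxy with hxy | ⟨rfl, -⟩
      · exact ⟨p, x, y, s, rfl, rfl, hxy⟩
      · exact absurd h (not_red_pair _ _ _)
  | succ n ih =>
    cases hb with
    | next _ _ _ j _ hn hj hij hc hv =>
      have hr' : Red ((dec (p ++ x :: y :: s) j).eraseIdx j) := by
        rw [eraseIdx_dec]; exact Red.eraseIdx_congr hi hr hj hc
      have hj' : j < (dec (p ++ x :: y :: s) j).length := by simpa using hj
      rcases hxy with hxy | ⟨rfl, rfl⟩
      · obtain ⟨p₀, x₀, y₀, s₀, he, hp, hxy₀⟩ := dec_ascent p s hxy j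
        rw [he] at hv hr' hj'
        rw [← hp] at hxy₀ ⊢
        exact ih hv hj' hr' hxy₀
      · obtain rfl := conflict_unique hi hr hj hij hc (k := p.length) (by simp) (by simp)
          (crossing_pair p s x)
        rw [dec_length] at hv hr' hj'
        exact ih hv hj' hr' (by omega)

theorem dec_descent (p s : List ℤ) {x y : ℤ} (hxy : y < x) (j : ℕ) :
    ∃ p' x' y' s', dec (p ++ x :: y :: s) j = p' ++ x' :: y' :: s' ∧ p'.length = p.length ∧
      (y' < x' ∨ x' = y' ∧ j = p.length) := by
  rcases lt_or_ge j p.length with hjp | hjp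
  · exact ⟨dec p j, x, y, s, dec_append_left _ hjp, by simp, .inl hxy⟩
  · obtain ⟨k, rfl⟩ := Nat.exists_eq_add_of_le hjp
    rcases k with _ | _ | k <;> rw [dec_append_right] <;>
      simp only [dec_cons_zero, dec_cons_succ] <;> refine ⟨p, _, _, _, rfl, rfl, ?_⟩ <;> omega

/-- The mirror image of `Bump.ascent`. -/
theorem Bump.descent {n : ℕ} {p s : List ℤ} {x y : ℤ} {i : ℕ} {v : List ℤ}
    (hb : Bump n (p ++ x :: y :: s) i v) (hi : i < (p ++ x :: y :: s).length)
    (hr : Red ((p ++ x :: y :: s).eraseIdx i)) (hxy : y < x ∨ x = y ∧ i = p.length) :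
    ∃ p' x' y' s', v = p' ++ x' :: y' :: s' ∧ p'.length = p.length ∧ y' < x' := by
  induction n generalizing p x y s i with
  | zero =>
    cases hb with
    | done _ _ h =>
      rcases hxy with hxy | ⟨rfl, -⟩
      · exact ⟨p, x, y, s, rfl, rfl, hxy⟩
      · exact absurd h (not_red_pair _ _ _)
  | succ n ih =>
    cases hb with
    | next _ _ _ j _ hn hj hij hc hv =>
      have hr' : Red ((dec (p ++ x :: y :: s) j).eraseIdx j) := by
        rw [eraseIdx_dec]; exact Red.eraseIdx_congr hi hr hj hc
      have hj' : j < (dec (p ++ x :: y :: s) j).length := by simpa using hj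
      rcases hxy with hxy | ⟨rfl, rfl⟩
      · obtain ⟨p₀, x₀, y₀, s₀, he, hp, hxy₀⟩ := dec_descent p s hxy j
        rw [he] at hv hr' hj'
        rw [← hp] at hxy₀ ⊢
        exact ih hv hj' hr' hxy₀
      · obtain rfl := conflict_unique hi hr hj hij hc (k := p.length + 1) (by simp) (by simp)
          (crossing_pair p s x).symm
        rw [dec_length_add_one] at hv hr' hj'
        exact ih hv hj' hr' (by omega)

/-! ### Bumps commute with Coxeter-Knuth moves -/

/-- The Coxeter-Knuth move on three consecutive letters `x < y > z`: it turns `a c b` into `c a b`,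
`b c a` into `b a c` (for `a < b < c`), and `a b a` into `b a b`. -/
def ck {α : Type*} [LinearOrder α] (x y z : α) : List α :=
  if x < z then [y, x, z] else if z < x then [x, z, y] else [y, x, y]

/-- The position, after a Coxeter-Knuth move on the positions `n`, `n + 1`, `n + 2` with outer
letters `x` and `z`, of the letter that swaps the same values as the letter at a given position
did before. -/
def ckPos (n : ℕ) (x z : ℤ) : Equiv.Perm ℕ :=
  if x < z then Equiv.swap n (n + 1)
  else if z < x then Equiv.swap (n + 1) (n + 2)
  else Equiv.swap n (n + 2)

/-- `x y z` is a peak to which a Coxeter-Knuth move applies. -/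
def IsPeak (x y z : ℤ) : Prop := x < y ∧ z < y ∧ (x = z → y = x + 1)

section

variable {α : Type*} [LinearOrder α] {x z : α} (y : α)

theorem ck_of_lt (h : x < z) : ck x y z = [y, x, z] := by simp [ck, h]

theorem ck_of_gt (h : z < x) : ck x y z = [x, z, y] := by simp [ck, h, h.not_gt]

theorem ck_self (x y : α) : ck x y x = [y, x, y] := by simp [ck]

@[simp] theorem length_ck (x y z : α) : (ck x y z).length = 3 := by
  unfold ck; split_ifs <;> rfl

end

section

variable {x z : ℤ} (n : ℕ)

theorem ckPos_of_outside (x z : ℤ) {j : ℕ} (h : j < n ∨ n + 3 ≤ j) : ckPos n x z j = j := by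
  unfold ckPos
  split_ifs <;> apply Equiv.swap_apply_of_ne_of_ne <;> omega

theorem ckPos_of_lt (h : x < z) :
    ckPos n x z n = n + 1 ∧ ckPos n x z (n + 1) = n ∧ ckPos n x z (n + 2) = n + 2 := by
  simp [ckPos, h, Equiv.swap_apply_def]

theorem ckPos_of_gt (h : z < x) :
    ckPos n x z n = n ∧ ckPos n x z (n + 1) = n + 2 ∧ ckPos n x z (n + 2) = n + 1 := by
  simp [ckPos, h, h.not_gt, Equiv.swap_apply_def]

theorem ckPos_self (x : ℤ) :
    ckPos n x x n = n + 2 ∧ ckPos n x x (n + 1) = n + 1 ∧ ckPos n x x (n + 2) = n := by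
  simp [ckPos, Equiv.swap_apply_def]

theorem ckPos_lt (x z : ℤ) {j m : ℕ} (h : j < n + 3 + m) : ckPos n x z j < n + 3 + m := by
  unfold ckPos
  split_ifs <;> simp only [Equiv.swap_apply_def] <;> split_ifs <;> omega

end

theorem intPerm_ck {x y z : ℤ} (h : IsPeak x y z) : intPerm (ck x y z) = intPerm [x, y, z] := by
  obtain ⟨h1, h2, h3⟩ := h
  rcases lt_trichotomy x z with hxz | rfl | hxz
  · simp [ck_of_lt y hxz, ← mul_assoc, adjSwap_comm (show x + 2 ≤ y ∨ _ from .inl (by omega))]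
  · obtain rfl := h3 rfl
    simp [ck_self, adjSwap_braid]
  · simp [ck_of_gt y hxz, adjSwap_comm (show z + 2 ≤ y ∨ _ from .inl (by omega))]

theorem intPerm_ck_append (p s : List ℤ) {x y z : ℤ} (h : IsPeak x y z) :
    intPerm (p ++ (ck x y z ++ s)) = intPerm (p ++ x :: y :: z :: s) := by
  rw [intPerm_append, intPerm_append, intPerm_append, intPerm_ck h]
  simp [mul_assoc]

theorem red_ck_iff (p s : List ℤ) {x y z : ℤ} (h : IsPeak x y z) :
    Red (p ++ (ck x y z ++ s)) ↔ Red (p ++ x :: y :: z :: s) := by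
  have hl : (p ++ (ck x y z ++ s)).length = (p ++ x :: y :: z :: s).length := by simp; omega
  exact ⟨fun hr => hr.of_intPerm_eq (intPerm_ck_append p s h).symm hl.symm,
    fun hr => hr.of_intPerm_eq (intPerm_ck_append p s h) hl⟩

theorem Red.isPeak {p s : List ℤ} {x y z : ℤ} (hr : Red (p ++ x :: y :: z :: s)) (h1 : x < y)
    (h2 : z < y) : IsPeak x y z := by
  refine ⟨h1, h2, ?_⟩
  rintro rfl
  by_contra hne
  exact not_red_sandwich p s (.inl (by omega)) hr

/-- `ckPos` matches the letters before and after the move that have the same crossing. -/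
theorem crossing_ck (p s : List ℤ) {x y z : ℤ} (h : IsPeak x y z) (j : ℕ) :
    crossing (p ++ (ck x y z ++ s)) (ckPos p.length x z j) =
      crossing (p ++ x :: y :: z :: s) j := by
  rcases lt_or_ge j p.length with hj | hj
  · rw [ckPos_of_outside _ _ _ (.inl hj), crossing_append_left _ hj, crossing_append_left _ hj]
  obtain ⟨k, rfl⟩ := Nat.exists_eq_add_of_le hj
  rcases Nat.lt_or_ge k 3 with hk | hk
  · obtain ⟨h1, h2, h3⟩ := h
    rcases lt_trichotomy x z with hxz | rfl | hxz
    · obtain ⟨e0, e1, e2⟩ := ckPos_of_lt p.length hxz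
      have hcomm := adjSwap_comm (show x + 2 ≤ y ∨ _ from .inl (by omega))
      rcases k with _ | _ | _ | k <;> simp only [zero_add, add_zero, e0, e1, e2, ck_of_lt y hxz,
        crossing_append_right, crossing_append_length, List.cons_append, List.nil_append,
        crossing_cons_zero, crossing_cons_succ]
      · simp [← hcomm, mul_assoc]
      · simp [hcomm, mul_assoc]
      · have h' : ∀ σ, adjSwap x * (adjSwap y * σ) = adjSwap y * (adjSwap x * σ) := fun σ => by
          rw [← mul_assoc, hcomm, mul_assoc]
        simp [hcomm, h', mul_assoc]
      · omega
    · obtain rfl := h3 rfl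
      obtain ⟨e0, e1, e2⟩ := ckPos_self p.length x
      have hb := adjSwap_braid x
      have hb' : ∀ σ, adjSwap x * (adjSwap (x + 1) * (adjSwap x * σ)) =
          adjSwap (x + 1) * (adjSwap x * (adjSwap (x + 1) * σ)) := fun σ => by
        simpa only [mul_assoc] using congrArg (· * σ) hb
      rcases k with _ | _ | _ | k <;> simp only [zero_add, add_zero, e0, e1, e2, ck_self,
        crossing_append_right, crossing_append_length, List.cons_append, List.nil_append,
        crossing_cons_zero, crossing_cons_succ]
      · simp [mul_assoc, hb']
      · simp [mul_assoc, hb']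
      · simp [mul_assoc, hb']
      · omega
    · obtain ⟨e0, e1, e2⟩ := ckPos_of_gt p.length hxz
      have hcomm := adjSwap_comm (show z + 2 ≤ y ∨ _ from .inl (by omega))
      have h' : ∀ σ, adjSwap z * (adjSwap y * σ) = adjSwap y * (adjSwap z * σ) := fun σ => by
        rw [← mul_assoc, hcomm, mul_assoc]
      rcases k with _ | _ | _ | k <;> simp only [zero_add, add_zero, e0, e1, e2, ck_of_gt y hxz,
        crossing_append_right, crossing_append_length, List.cons_append, List.nil_append,
        crossing_cons_zero, crossing_cons_succ]
      · simp [h', mul_assoc]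
      · simp [h', mul_assoc]
      · omega
  · obtain ⟨m, rfl⟩ := Nat.exists_eq_add_of_le hk
    rw [ckPos_of_outside _ _ _ (.inr (by omega)), crossing_append_right, crossing_append_right]
    have := crossing_append_right (ck x y z) s m
    rw [length_ck] at this
    have h3 := crossing_append_right [x, y, z] s m
    simp only [List.length_cons, List.length_nil, zero_add, Nat.reduceAdd, List.cons_append,
      List.nil_append] at h3
    rw [this, intPerm_ck h, h3]

/-- `StepsTo u i u' i'`: the process at the word `u`, whose letter at `i` was decremented last, may
get to the word `u'`, whose letter at `i'` was decremented last. -/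
def StepsTo (u : List ℤ) (i : ℕ) (u' : List ℤ) (i' : ℕ) : Prop :=
  ∀ m v, Bump m u' i' v → ∃ m', Bump m' u i v

theorem StepsTo.refl (u : List ℤ) (i : ℕ) : StepsTo u i u i := fun m _ h => ⟨m, h⟩

theorem StepsTo.next {u : List ℤ} {i j : ℕ} (h : ¬ Red u) (hj : j < u.length) (hij : j ≠ i)
    (hc : crossing u j = crossing u i) : StepsTo u i (dec u j) j :=
  fun m v hb => ⟨m + 1, .next m u i j v h hj hij hc hb⟩

section

variable (p s : List ℤ)

theorem stepsTo_pair_left (a : ℤ) :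
    StepsTo (p ++ a :: a :: s) p.length (p ++ a :: (a - 1) :: s) (p.length + 1) := by
  simpa only [dec_length_add_one] using StepsTo.next (not_red_pair p s a)
    (show p.length + 1 < _ by simp) (by omega) (crossing_pair p s a).symm

theorem stepsTo_pair_right (a : ℤ) :
    StepsTo (p ++ a :: a :: s) (p.length + 1) (p ++ (a - 1) :: a :: s) p.length := by
  simpa only [dec_length] using StepsTo.next (not_red_pair p s a)
    (show p.length < _ by simp) (by omega) (crossing_pair p s a)

theorem stepsTo_sandwich_left {a c : ℤ} (h : a + 2 ≤ c ∨ c + 2 ≤ a) :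
    StepsTo (p ++ a :: c :: a :: s) p.length (p ++ a :: c :: (a - 1) :: s) (p.length + 2) := by
  simpa only [dec_length_add_two] using StepsTo.next (not_red_sandwich p s h)
    (show p.length + 2 < _ by simp) (by omega) (crossing_sandwich p s h).symm

theorem stepsTo_sandwich_right {a c : ℤ} (h : a + 2 ≤ c ∨ c + 2 ≤ a) :
    StepsTo (p ++ a :: c :: a :: s) (p.length + 2) (p ++ (a - 1) :: c :: a :: s) p.length := by
  simpa only [dec_length] using StepsTo.next (not_red_sandwich p s h)
    (show p.length < _ by simp) (by omega) (crossing_sandwich p s h)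

end

/-- `InProcess v N u i`: the process at `u`, whose letter at `i` was decremented last, ends in `v`
after at most `N` further decrementations. -/
def InProcess (v : List ℤ) (N : ℕ) (u : List ℤ) (i : ℕ) : Prop :=
  i < u.length ∧ Red (u.eraseIdx i) ∧ ∃ n ≤ N, Bump n u i v

theorem InProcess.next {v : List ℤ} {N : ℕ} {u : List ℤ} {i : ℕ} (h : InProcess v N u i) {j : ℕ}
    (hn : ¬ Red u) (hj : j < u.length) (hij : j ≠ i) (hc : crossing u j = crossing u i) :
    InProcess v N (dec u j) j := by
  obtain ⟨hi, hr, n, hnN, hb⟩ := h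
  obtain ⟨m, hm, hb'⟩ := hb.forced hi hr hn hj hij hc
  exact ⟨by simpa using hj, by rw [eraseIdx_dec]; exact Red.eraseIdx_congr hi hr hj hc,
    m, by omega, hb'⟩

section

variable {v : List ℤ} {N : ℕ} {p s : List ℤ}

theorem InProcess.pair_left {a : ℤ} (h : InProcess v N (p ++ a :: a :: s) p.length) :
    InProcess v N (p ++ a :: (a - 1) :: s) (p.length + 1) := by
  simpa only [dec_length_add_one] using h.next (not_red_pair p s a)
    (show p.length + 1 < _ by simp) (by omega) (crossing_pair p s a).symm

theorem InProcess.pair_right {a : ℤ} (h : InProcess v N (p ++ a :: a :: s) (p.length + 1)) :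
    InProcess v N (p ++ (a - 1) :: a :: s) p.length := by
  simpa only [dec_length] using h.next (not_red_pair p s a)
    (show p.length < _ by simp) (by omega) (crossing_pair p s a)

theorem InProcess.sandwich_left {a c : ℤ} (hac : a + 2 ≤ c ∨ c + 2 ≤ a)
    (h : InProcess v N (p ++ a :: c :: a :: s) p.length) :
    InProcess v N (p ++ a :: c :: (a - 1) :: s) (p.length + 2) := by
  simpa only [dec_length_add_two] using h.next (not_red_sandwich p s hac)
    (show p.length + 2 < _ by simp) (by omega) (crossing_sandwich p s hac).symm

theorem InProcess.sandwich_right {a c : ℤ} (hac : a + 2 ≤ c ∨ c + 2 ≤ a)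
    (h : InProcess v N (p ++ a :: c :: a :: s) (p.length + 2)) :
    InProcess v N (p ++ (a - 1) :: c :: a :: s) p.length := by
  simpa only [dec_length] using h.next (not_red_sandwich p s hac)
    (show p.length < _ by simp) (by omega) (crossing_sandwich p s hac)

/-- Decrementing a letter in a window `x y z` that is a peak, or the corresponding letter in the
window after the Coxeter-Knuth move, leads to windows that are again a peak and its Coxeter-Knuth
move, where the letters decremented last again correspond to each other.  Either process needs at
most one more step inside the window to get there. -/
theorem window_step {x y z : ℤ} (hpk : IsPeak x y z) {j : ℕ}
    (h : InProcess v N (dec (p ++ x :: y :: z :: s) j) j) :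
    ∃ p' x' y' z' s' i, p'.length = p.length ∧ IsPeak x' y' z' ∧
      InProcess v N (p' ++ x' :: y' :: z' :: s') i ∧
      StepsTo (dec (p ++ (ck x y z ++ s)) (ckPos p.length x z j)) (ckPos p.length x z j)
        (p' ++ (ck x' y' z' ++ s')) (ckPos p.length x' z' i) := by
  rcases lt_or_ge j p.length with hj | hj
  · rw [dec_append_left _ hj] at h
    refine ⟨dec p j, x, y, z, s, j, by simp, hpk, h, ?_⟩
    rw [ckPos_of_outside _ _ _ (.inl hj), dec_append_left _ hj]
    exact .refl _ _
  obtain ⟨k, rfl⟩ := Nat.exists_eq_add_of_le hj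
  rcases Nat.lt_or_ge k 3 with hk | hk
  swap
  · obtain ⟨m, rfl⟩ := Nat.exists_eq_add_of_le hk
    have h1 := dec_append_right [x, y, z] s m
    simp only [List.length_cons, List.length_nil, zero_add, Nat.reduceAdd, List.cons_append,
      List.nil_append] at h1
    have h2 := dec_append_right (ck x y z) s m
    rw [length_ck] at h2
    rw [dec_append_right, h1] at h
    refine ⟨p, x, y, z, dec s m, _, rfl, hpk, h, ?_⟩
    rw [ckPos_of_outside _ _ _ (.inr (by omega)), dec_append_right, h2]
    exact .refl _ _
  obtain ⟨hxy, hzy, hxz⟩ := hpk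
  have hk' : k = 0 ∨ k = 1 ∨ k = 2 := by omega
  rcases lt_trichotomy x z with hlt | rfl | hgt
  · obtain ⟨e0, e1, e2⟩ := ckPos_of_lt p.length hlt
    rw [ck_of_lt y hlt]
    rcases hk' with rfl | rfl | rfl
    · rw [add_zero, dec_length] at h
      refine ⟨p, x - 1, y, z, s, _, rfl, ⟨by omega, hzy, by omega⟩, h, ?_⟩
      obtain ⟨f0, f1, f2⟩ := ckPos_of_lt (x := x - 1) (z := z) p.length (by omega)
      rw [ck_of_lt _ (by omega), add_zero, e0, f0, List.cons_append, List.cons_append,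
        dec_length_add_one]
      exact .refl _ _
    · rw [dec_length_add_one] at h
      rw [e1, List.cons_append, List.cons_append, List.cons_append, List.nil_append, dec_length]
      rcases (show z < y - 1 ∨ y = z + 1 by omega) with hy | rfl
      · refine ⟨p, x, y - 1, z, s, _, rfl, ⟨by omega, hy, by omega⟩, h, ?_⟩
        rw [ck_of_lt _ hlt, e1]
        exact .refl _ _
      · rw [add_sub_cancel_right] at h ⊢
        have h' : InProcess v N (p ++ x :: z :: (z - 1) :: s) (p.length + 2) := by
          simpa using InProcess.pair_left (p := p ++ [x]) (by simpa using h)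
        rcases (show x < z - 1 ∨ z = x + 1 by omega) with hx | rfl
        · refine ⟨p, x, z, z - 1, s, _, rfl, ⟨hlt, by omega, by omega⟩, h', ?_⟩
          obtain ⟨f0, f1, f2⟩ := ckPos_of_lt (x := x) (z := z - 1) p.length hx
          rw [ck_of_lt _ hx, f2]
          exact stepsTo_sandwich_left p s (.inr (by omega))
        · rw [add_sub_cancel_right] at h'
          refine ⟨p, x, x + 1, x, s, _, rfl, ⟨hlt, hlt, by omega⟩, h', ?_⟩
          rw [ck_self, (ckPos_self p.length x).2.2]
          exact .refl _ _
    · rw [dec_length_add_two] at h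
      rw [e2, List.cons_append, List.cons_append, List.cons_append, List.nil_append,
        dec_length_add_two]
      rcases (show x < z - 1 ∨ z = x + 1 by omega) with hx | rfl
      · refine ⟨p, x, y, z - 1, s, _, rfl, ⟨hxy, by omega, by omega⟩, h, ?_⟩
        rw [ck_of_lt _ hx, (ckPos_of_lt p.length hx).2.2]
        exact .refl _ _
      · rw [add_sub_cancel_right] at h ⊢
        have hx : x - 1 < x := by omega
        refine ⟨p, x - 1, y, x, s, _, rfl, ⟨by omega, hxy, by omega⟩,
          h.sandwich_right (.inl (by omega)), ?_⟩
        rw [ck_of_lt _ hx, (ckPos_of_lt p.length hx).1]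
        simpa using stepsTo_pair_right (p ++ [y]) s x
  · obtain rfl := hxz rfl
    obtain ⟨e0, e1, e2⟩ := ckPos_self p.length x
    have hx : x - 1 < x := by omega
    rw [ck_self]
    rcases hk' with rfl | rfl | rfl
    · rw [add_zero, dec_length] at h
      refine ⟨p, x - 1, x + 1, x, s, _, rfl, ⟨by omega, by omega, by omega⟩, h, ?_⟩
      rw [ck_of_lt _ hx, add_zero, e0, (ckPos_of_lt p.length hx).1, List.cons_append,
        List.cons_append, List.cons_append, List.nil_append, dec_length_add_two,
        add_sub_cancel_right]
      simpa using stepsTo_pair_right (p ++ [x + 1]) s x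
    · -- The middle letter cannot be decremented: the other two form the factor `x x`.
      have := h.2.1
      rw [dec_length_add_one, List.eraseIdx_append_of_length_le (by omega)] at this
      simp only [Nat.add_sub_cancel_left, List.eraseIdx_cons_succ, List.eraseIdx_cons_zero] at this
      exact absurd this (not_red_pair p s x)
    · rw [dec_length_add_two] at h
      refine ⟨p, x, x + 1, x - 1, s, _, rfl, ⟨by omega, by omega, by omega⟩, h, ?_⟩
      rw [ck_of_gt _ hx, e2, (ckPos_of_gt p.length hx).2.2, List.cons_append,
        List.cons_append, List.cons_append, List.nil_append, dec_length,
        add_sub_cancel_right]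
      exact stepsTo_pair_left p _ x
  · obtain ⟨e0, e1, e2⟩ := ckPos_of_gt p.length hgt
    rw [ck_of_gt y hgt]
    rcases hk' with rfl | rfl | rfl
    · rw [add_zero, dec_length] at h
      rw [add_zero, e0, List.cons_append, List.cons_append, List.cons_append, List.nil_append,
        dec_length]
      rcases (show z < x - 1 ∨ x = z + 1 by omega) with hx | rfl
      · refine ⟨p, x - 1, y, z, s, _, rfl, ⟨by omega, hzy, by omega⟩, h, ?_⟩
        rw [ck_of_gt _ hx, (ckPos_of_gt p.length hx).1]
        exact .refl _ _
      · rw [add_sub_cancel_right] at h ⊢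
        have hz : z - 1 < z := by omega
        refine ⟨p, z, y, z - 1, s, _, rfl, ⟨by omega, by omega, by omega⟩,
          h.sandwich_left (.inl (by omega)), ?_⟩
        rw [ck_of_gt _ hz, (ckPos_of_gt p.length hz).2.2]
        exact stepsTo_pair_left p _ z
    · rw [dec_length_add_one] at h
      rw [e1, List.cons_append, List.cons_append, List.cons_append, List.nil_append,
        dec_length_add_two]
      rcases (show x < y - 1 ∨ y = x + 1 by omega) with hy | rfl
      · refine ⟨p, x, y - 1, z, s, _, rfl, ⟨hy, by omega, by omega⟩, h, ?_⟩
        rw [ck_of_gt _ hgt, e1]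
        exact .refl _ _
      · rw [add_sub_cancel_right] at h ⊢
        have h' := h.pair_right
        rcases (show z < x - 1 ∨ x = z + 1 by omega) with hx | rfl
        · refine ⟨p, x - 1, x, z, s, _, rfl, ⟨by omega, hgt, by omega⟩, h', ?_⟩
          rw [ck_of_gt _ hx, (ckPos_of_gt p.length hx).1]
          exact stepsTo_sandwich_right p s (.inr (by omega))
        · rw [add_sub_cancel_right] at h'
          refine ⟨p, z, z + 1, z, s, _, rfl, ⟨by omega, by omega, by omega⟩, h', ?_⟩
          rw [ck_self, (ckPos_self p.length z).1]
          exact .refl _ _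
    · rw [dec_length_add_two] at h
      have hz : z - 1 < x := by omega
      refine ⟨p, x, y, z - 1, s, _, rfl, ⟨hxy, by omega, by omega⟩, h, ?_⟩
      rw [e2, ck_of_gt _ hz, (ckPos_of_gt p.length hz).2.2, List.cons_append, List.cons_append,
        List.cons_append, List.nil_append, dec_length_add_one]
      exact .refl _ _

end

/-- The bump started at a letter of a word and the bump started at the corresponding letter of its
Coxeter-Knuth move have results that are again related by this move. -/
theorem bump_ck {v : List ℤ} {N : ℕ} {p s : List ℤ} {x y z : ℤ} (hpk : IsPeak x y z) {j : ℕ}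
    (h : InProcess v N (dec (p ++ x :: y :: z :: s) j) j) :
    ∃ p' x' y' z' s' m, v = p' ++ x' :: y' :: z' :: s' ∧ p'.length = p.length ∧
      IsPeak x' y' z' ∧
      Bump m (dec (p ++ (ck x y z ++ s)) (ckPos p.length x z j)) (ckPos p.length x z j)
        (p' ++ (ck x' y' z' ++ s')) := by
  induction N using Nat.strong_induction_on generalizing p x y z s j with
  | _ N IH =>
    obtain ⟨p', x', y', z', s', i, hp, hpk', ⟨hi, hr, n, hnN, hb⟩, hst⟩ := window_step hpk h
    cases hb with
    | done _ _ hred =>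
      obtain ⟨m, hm⟩ := hst 0 _ (.done _ _ ((red_ck_iff p' s' hpk').2 hred))
      exact ⟨p', x', y', z', s', m, rfl, hp, hpk', hm⟩
    | next n _ _ j' _ hn hj hij hc hv =>
      obtain ⟨p₁, x₁, y₁, z₁, s₁, m, rfl, hp₁, hpk₁, hm⟩ := IH n (by omega) hpk'
        (j := j') (p := p') (s := s') ⟨by simpa using hj,
          by rw [eraseIdx_dec]; exact Red.eraseIdx_congr hi hr hj hc, n, le_rfl, hv⟩
      rw [← hp] at hst
      obtain ⟨m', hm'⟩ := hst (m + 1) _ (.next m _ _ (ckPos p'.length x' z' j') _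
        (by rwa [red_ck_iff p' s' hpk'])
        (by
          have := ckPos_lt p'.length x' z' (j := j') (m := s'.length) (by
            simp at hj; omega)
          simp; omega)
        (fun he => hij ((ckPos p'.length x' z').injective he))
        (by rw [crossing_ck p' s' hpk', crossing_ck p' s' hpk', hc]) hm)
      exact ⟨p₁, x₁, y₁, z₁, s₁, m', rfl, hp₁.trans hp, hpk₁, by rwa [hp] at hm'⟩

/-! ### Translating words -/

/-- Add `c` to every letter. -/
def shift (c : ℤ) (w : List ℤ) : List ℤ := w.map (· + c)

@[simp] theorem length_shift (c : ℤ) (w : List ℤ) : (shift c w).length = w.length := by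
  simp [shift]

@[simp] theorem shift_neg_shift (c : ℤ) (w : List ℤ) : shift (-c) (shift c w) = w := by
  simp [shift, Function.comp_def]

theorem shift_shift (c d : ℤ) (w : List ℤ) : shift c (shift d w) = shift (d + c) w := by
  simp [shift, Function.comp_def, add_assoc]

theorem adjSwap_add (a c : ℤ) :
    adjSwap (a + c) = Equiv.addRight c * adjSwap a * (Equiv.addRight c)⁻¹ := by
  rw [adjSwap, adjSwap, ← Equiv.swap_apply_apply]
  simp [add_right_comm]

theorem intPerm_shift (c : ℤ) (w : List ℤ) :
    intPerm (shift c w) = Equiv.addRight c * intPerm w * (Equiv.addRight c)⁻¹ := by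
  induction w with
  | nil => exact (mul_inv_cancel _).symm
  | cons a w ih =>
    simp only [shift, List.map_cons, intPerm_cons] at ih ⊢
    rw [ih, adjSwap_add]
    group

theorem crossing_shift (c : ℤ) (w : List ℤ) {i : ℕ} (hi : i < w.length) :
    crossing (shift c w) i = Equiv.addRight c * crossing w i * (Equiv.addRight c)⁻¹ := by
  have h1 : (shift c w).take i = shift c (w.take i) := by simp [shift, List.map_take]
  have h2 : (shift c w).getD i 0 = w.getD i 0 + c := by simp [shift, hi]
  rw [crossing, crossing, h1, h2, intPerm_shift, adjSwap_add]
  group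

theorem crossing_shift_eq_iff (c : ℤ) {w : List ℤ} {i j : ℕ} (hi : i < w.length)
    (hj : j < w.length) :
    crossing (shift c w) i = crossing (shift c w) j ↔ crossing w i = crossing w j := by
  rw [crossing_shift c w hi, crossing_shift c w hj, mul_left_inj, mul_right_inj]

theorem Red.shift {w : List ℤ} (h : Red w) (c : ℤ) : Red (shift c w) := by
  intro v hv
  have := h (LittleEG.shift (-c) v) (by
    rw [intPerm_shift, hv, ← intPerm_shift, shift_neg_shift])
  simpa using this

@[simp] theorem red_shift_iff (c : ℤ) (w : List ℤ) : Red (shift c w) ↔ Red w :=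
  ⟨fun h => by simpa using h.shift (-c), fun h => h.shift c⟩

theorem dec_shift (c : ℤ) (w : List ℤ) (i : ℕ) : dec (shift c w) i = shift c (dec w i) := by
  induction w generalizing i with
  | nil => simp [dec, shift]
  | cons a w ih =>
    cases i with
    | zero => simp [shift, sub_add_eq_add_sub]
    | succ i => simpa [shift] using ih i

theorem eraseIdx_shift (c : ℤ) (w : List ℤ) (i : ℕ) :
    (shift c w).eraseIdx i = shift c (w.eraseIdx i) := by
  simp [shift, List.eraseIdx_map]

theorem Bump.shift {n : ℕ} {u v : List ℤ} {i : ℕ} (h : Bump n u i v) (hi : i < u.length) (c : ℤ) :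
    Bump n (shift c u) i (shift c v) := by
  induction h with
  | done u i h => exact .done _ _ (h.shift c)
  | next n u i j v hn hj hij hc hv ih =>
    refine .next n _ i j _ (by simpa) (by simpa) hij ?_ ?_
    · exact (crossing_shift_eq_iff c hj hi).2 hc
    · rw [dec_shift]
      exact ih (by simpa)

/-! ### Bumps of words of natural numbers -/

/-- A word of natural numbers as a word of integers. -/
def toInt (w : List ℕ) : List ℤ := w.map (↑)

@[simp] theorem length_toInt (w : List ℕ) : (toInt w).length = w.length := by simp [toInt]

@[simp] theorem toInt_cons (a : ℕ) (w : List ℕ) : toInt (a :: w) = (a : ℤ) :: toInt w := rfl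

@[simp] theorem toInt_append (v w : List ℕ) : toInt (v ++ w) = toInt v ++ toInt w := by
  simp [toInt]

theorem toInt_eraseIdx (w : List ℕ) (i : ℕ) : toInt (w.eraseIdx i) = (toInt w).eraseIdx i := by
  simp [toInt, List.eraseIdx_map]

/-- `w'` is, up to a translation of its letters, the result of a bump on the reduced word `w`. -/
def BumpRel (w w' : List ℕ) : Prop :=
  Red (toInt w) ∧ ∃ (c : ℤ) (i n : ℕ), i < w.length ∧ Red ((toInt w).eraseIdx i) ∧
    Bump n (dec (toInt w) i) i (shift c (toInt w'))

theorem map_ck {α β : Type*} [LinearOrder α] [LinearOrder β] {f : α → β} (hf : StrictMono f)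
    (x y z : α) : (ck x y z).map f = ck (f x) (f y) (f z) := by
  unfold ck
  simp only [hf.lt_iff_lt]
  split_ifs <;> rfl

namespace BumpRel

variable {w w' p p' s s' : List ℕ} {x x' y y' z z' : ℕ}

theorem red_right (h : BumpRel w w') : Red (toInt w') := by
  obtain ⟨-, c, i, n, -, -, hb⟩ := h
  simpa using hb.red

/-- Bumps preserve the positions of ascents. -/
theorem lt_iff (h : BumpRel (p ++ x :: y :: s) (p' ++ x' :: y' :: s'))
    (hp : p.length = p'.length) : x < y ↔ x' < y' := by
  obtain ⟨hr, c, i, n, hi, hri, hb⟩ := h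
  rw [← eraseIdx_dec] at hri
  have hi' : i < (dec (toInt (p ++ x :: y :: s)) i).length := by simpa using hi
  rw [toInt_append, toInt_cons, toInt_cons] at hr hri hb hi'
  have he : shift c (toInt (p' ++ x' :: y' :: s')) =
    shift c (toInt p') ++ (x' + c : ℤ) :: (y' + c : ℤ) :: shift c (toInt s') := by simp [shift]
  rw [he] at hb
  have hl : (shift c (toInt p')).length = p.length := by simp [hp]
  constructor
  · intro hxy
    obtain ⟨p₀, x₀, y₀, s₀, he₀, hp₀, hxy₀⟩ :=
      dec_ascent (toInt p) (toInt s) (show (x : ℤ) < y by exact_mod_cast hxy) i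
    rw [he₀] at hb hri hi'
    obtain ⟨p₁, x₁, y₁, s₁, he₁, hp₁, h₁⟩ := hb.ascent hi' hri (by rwa [hp₀])
    obtain ⟨-, h2⟩ := List.append_inj he₁ (by rw [hl, hp₁, hp₀, length_toInt])
    simp only [List.cons.injEq] at h2
    omega
  · intro hxy
    by_contra hle
    rcases (not_lt.mp hle).eq_or_lt with rfl | hyx
    · exact not_red_pair _ _ _ hr
    obtain ⟨p₀, x₀, y₀, s₀, he₀, hp₀, hxy₀⟩ :=
      dec_descent (toInt p) (toInt s) (show (y : ℤ) < x by exact_mod_cast hyx) i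
    rw [he₀] at hb hri hi'
    obtain ⟨p₁, x₁, y₁, s₁, he₁, hp₁, h₁⟩ := hb.descent hi' hri (by rwa [hp₀])
    obtain ⟨-, h2⟩ := List.append_inj he₁ (by rw [hl, hp₁, hp₀, length_toInt])
    simp only [List.cons.injEq] at h2
    omega

/-- Bumps commute with Coxeter-Knuth moves. -/
theorem ck (h : BumpRel (p ++ x :: y :: z :: s) (p' ++ x' :: y' :: z' :: s'))
    (hp : p.length = p'.length) (hxy : x < y) (hzy : z < y) :
    BumpRel (p ++ (ck x y z ++ s)) (p' ++ (LittleEG.ck x' y' z' ++ s')) := by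
  obtain ⟨hr, c, i, n, hi, hri, hb⟩ := h
  simp only [toInt_append, toInt_cons] at hr hri hb
  have hpk := hr.isPeak (by exact_mod_cast hxy) (by exact_mod_cast hzy)
  obtain ⟨p₁, x₁, y₁, z₁, s₁, m, he, hp₁, -, hm⟩ := bump_ck hpk (j := i) (N := n)
    ⟨by simpa using hi, by rwa [eraseIdx_dec], n, le_rfl, hb⟩
  have hcast : ∀ a b d : ℕ, toInt (LittleEG.ck a b d) = LittleEG.ck (a : ℤ) b d :=
    fun a b d => map_ck Int.natCast_strictMono a b d
  have hshift : ∀ a b d : ℤ, shift c (LittleEG.ck a b d) = LittleEG.ck (a + c) (b + c) (d + c) :=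
    fun a b d => map_ck (fun _ _ h => by simpa using h) a b d
  have he' : shift c (toInt p') = p₁ ∧
      (x' + c : ℤ) :: (y' + c : ℤ) :: (z' + c : ℤ) :: shift c (toInt s') =
        x₁ :: y₁ :: z₁ :: s₁ :=
    List.append_inj (by simpa [shift] using he) (by simp [hp₁, hp])
  simp only [List.cons.injEq] at he'
  obtain ⟨rfl, rfl, rfl, rfl, rfl⟩ := he'
  have hcr := crossing_ck (toInt p) (toInt s) hpk i
  rw [length_toInt] at hm hcr
  have hlt : ckPos p.length x z i < p.length + 3 + s.length :=
    ckPos_lt _ _ _ (by simp at hi; omega)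
  refine ⟨by simpa [hcast] using (red_ck_iff _ _ hpk).2 hr, c,
    ckPos p.length x z i, m, by simp; omega, ?_, ?_⟩
  · have hl : ∀ k : ℕ, k < p.length + 3 + s.length → k <
      (toInt p ++ (LittleEG.ck (x : ℤ) y z ++ toInt s)).length := fun k hk => by
        simp; omega
    have hl' : i < (toInt p ++ (x : ℤ) :: y :: z :: toInt s).length := by
      simp at hi ⊢; omega
    simp only [toInt_append, hcast]
    refine hri.of_intPerm_eq ?_ ?_
    · rw [intPerm_eraseIdx (hl _ hlt), intPerm_eraseIdx hl', hcr,
        intPerm_ck_append _ _ hpk]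
    · rw [List.length_eraseIdx_of_lt (hl _ hlt), List.length_eraseIdx_of_lt hl']
      simp; omega
  · have : shift c (toInt (p' ++ (LittleEG.ck x' y' z' ++ s'))) =
        shift c (toInt p') ++ (LittleEG.ck (x' + c : ℤ) (y' + c) (z' + c) ++
          shift c (toInt s')) := by
      rw [← hshift, ← hcast]; simp [shift]
    rw [this]
    simpa [hcast] using hm

end BumpRel

/-! ### Row insertion by Coxeter-Knuth moves -/

/-- The result of Coxeter-Knuth moves on the word `x y l`, where `x < y` and `y l` is decreasing:
the moves are made at the first three letters, then at the letters two to four, and so on, up to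
the last three. -/
def sweep (x y : ℕ) : List ℕ → List ℕ
  | [] => [x, y]
  | z :: l =>
    if x < z then y :: sweep x z l else if z < x then x :: sweep z y l else y :: sweep x y l

theorem exists_sweep_cons (x y z : ℕ) :
    ∃ a b c, ck x y z = [a, b, c] ∧ (∀ l, sweep x y (z :: l) = a :: sweep b c l) ∧
      (x < y → z < y → b < c ∧ z ≤ c) := by
  rcases lt_trichotomy x z with h | rfl | h
  · exact ⟨y, x, z, ck_of_lt y h, fun l => by simp [sweep, h], fun _ _ => ⟨h, le_rfl⟩⟩
  · exact ⟨y, x, y, ck_self x y, fun l => by simp [sweep], fun h _ => ⟨h, h.le⟩⟩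
  · exact ⟨x, z, y, ck_of_gt y h, fun l => by simp [sweep, h, h.not_gt], fun _ h => ⟨h, h.le⟩⟩

theorem BumpRel.sweep {p p' s s' l l' : List ℕ} {x x' y y' : ℕ}
    (h : BumpRel (p ++ x :: y :: (l ++ s)) (p' ++ x' :: y' :: (l' ++ s')))
    (hp : p.length = p'.length) (hl : l.length = l'.length) (hxy : x < y)
    (hd : (y :: l).Pairwise (· > ·)) :
    BumpRel (p ++ (sweep x y l ++ s)) (p' ++ (LittleEG.sweep x' y' l' ++ s')) := by
  induction l generalizing p p' l' x x' y y' with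
  | nil =>
    obtain rfl := List.eq_nil_of_length_eq_zero hl.symm
    exact h
  | cons z l ih =>
    obtain _ | ⟨z', l'⟩ := l'
    · simp at hl
    obtain ⟨a, b, c, hck, hsw, hbc⟩ := exists_sweep_cons x y z
    obtain ⟨a', b', c', hck', hsw', -⟩ := exists_sweep_cons x' y' z'
    rw [List.pairwise_cons, List.pairwise_cons] at hd
    have hzy : z < y := hd.1 z (by simp)
    obtain ⟨hbc, hzc⟩ := hbc hxy hzy
    have h1 := BumpRel.ck h hp hxy hzy
    rw [hck, hck'] at h1
    have h2 := ih (p := p ++ [a]) (p' := p' ++ [a']) (l' := l') (x := b) (x' := b') (y := c)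
      (y' := c') (by simpa using h1) (by simp [hp]) (by simpa using hl) hbc
      (List.pairwise_cons.2 ⟨fun t ht => (hd.2.1 t ht).trans_le hzc, hd.2.2⟩)
    rw [hsw, hsw']
    simpa using h2

/-- While the next letter exceeds `a`, the moves carry `a` past the larger letters of the row. -/
theorem sweep_append {a h y : ℕ} {H t l : List ℕ} (he : h :: l = H ++ y :: t)
    (hH : ∀ b ∈ H, a < b) (hy : a < y) : sweep a h l = H ++ sweep a y t := by
  induction H generalizing h l with
  | nil =>
    obtain ⟨rfl, rfl⟩ := List.cons.inj he
    rfl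
  | cons b H ih =>
    rw [List.cons_append, List.cons.injEq] at he
    obtain ⟨rfl, rfl⟩ := he
    obtain ⟨h', l', he', hlt⟩ : ∃ h' l', h' :: l' = H ++ y :: t ∧ a < h' := by
      cases H with
      | nil => exact ⟨y, t, rfl, hy⟩
      | cons c H => exact ⟨c, H ++ y :: t, rfl, hH c (by simp)⟩
    rw [← he', sweep, if_pos hlt, ih he' fun b hb => hH b (by simp [hb])]
    rfl

/-- Once `x` exceeds the rest of the row, the moves carry `y` to the end. -/
theorem sweep_of_pairwise {x : ℕ} (y : ℕ) {t : List ℕ} (h : (x :: t).Pairwise (· > ·)) :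
    sweep x y t = x :: t ++ [y] := by
  induction t generalizing x with
  | nil => rfl
  | cons z t ih =>
    rw [List.pairwise_cons] at h
    have hzx : z < x := h.1 z (by simp)
    rw [sweep, if_neg hzx.not_gt, if_pos hzx, ih h.2]
    rfl

theorem rowInsert_of_forall_le {x : ℕ} {R : List ℕ} (h : ∀ r ∈ R, r ≤ x) :
    rowInsert x R = (R ++ [x], none) := by
  have : R.dropWhile (· ≤ x) = [] := by simpa using h
  simp [rowInsert, this]

theorem rowInsert_append_cons {x y : ℕ} {L H : List ℕ} (hL : ∀ r ∈ L, r ≤ x) (hy : x < y) :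
    rowInsert x (L ++ y :: H) =
      if y = x + 1 ∧ L.getLast? = some x then (L ++ y :: H, some (x + 1))
      else (L ++ x :: H, some y) := by
  have h1 : (L ++ y :: H).dropWhile (· ≤ x) = y :: H := by
    rw [List.dropWhile_append_of_pos (by simpa using hL)]
    simp [hy]
  have h2 : (L ++ y :: H).takeWhile (· ≤ x) = L := by
    rw [List.takeWhile_append_of_pos (by simpa using hL)]
    simp [hy]
  simp only [rowInsert, h1, h2]

theorem intPerm_comm {a : ℤ} {H : List ℤ} (h : ∀ b ∈ H, a + 2 ≤ b) :
    adjSwap a * intPerm H = intPerm H * adjSwap a := by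
  induction H with
  | nil => simp
  | cons b H ih =>
    rw [intPerm_cons, ← mul_assoc, adjSwap_comm (.inl (h b (by simp))), mul_assoc,
      ih fun c hc => h c (by simp [hc]), mul_assoc]

/-- If some entry of the row exceeds `a`, the moves of `sweep` carry out the row insertion of `a`:
in front there is the reading of the new row, and the last letter is the entry to be inserted in
the next row.  If `a` is an entry, then so is `a + 1`, as otherwise the word would not be
reduced. -/
theorem rowInsert_eq_sweep {p s R t : List ℕ} {a h : ℕ}
    (hr : Red (toInt (p ++ a :: (R.reverse ++ s)))) (hR : R.Pairwise (· < ·))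
    (he : R.reverse = h :: t) (hah : a < h) :
    ∃ R₁ y, rowInsert a R = (R₁, some y) ∧ R₁.length = R.length ∧ R₁.Pairwise (· < ·) ∧
      sweep a h t = R₁.reverse ++ [y] := by
  obtain ⟨L, y, H, rfl, hL, hy⟩ : ∃ L y H, R = L ++ y :: H ∧ (∀ r ∈ L, r ≤ a) ∧ a < y := by
    have hne : R.dropWhile (· ≤ a) ≠ [] := by
      simp only [ne_eq, List.dropWhile_eq_nil_iff, not_forall]
      exact ⟨h, by rw [← List.mem_reverse, he]; simp, by simpa using hah⟩
    obtain ⟨y, H, hyH⟩ := List.exists_cons_of_ne_nil hne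
    refine ⟨R.takeWhile (· ≤ a), y, H, ?_, ?_, ?_⟩
    · rw [← hyH, List.takeWhile_append_dropWhile]
    · intro r hr
      simpa using List.mem_takeWhile_imp hr
    · have := List.head_dropWhile_not (fun r => decide (r ≤ a)) hne
      simpa [hyH] using this
  rw [List.reverse_append, List.reverse_cons, List.append_assoc, List.singleton_append] at he
  rw [List.pairwise_append, List.pairwise_cons] at hR
  obtain ⟨hLp, ⟨hyH, hHp⟩, hLH⟩ := hR
  have hLr : L.reverse.Pairwise (· > ·) := by simpa [List.pairwise_reverse] using hLp
  rw [sweep_append he.symm (by simpa using fun b hb => hy.trans (hyH b hb)) hy,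
    rowInsert_append_cons hL hy]
  -- In all cases but the special bump the entry `y` is replaced by `a`.
  have hnormal : (∀ b ∈ L, b < a) → ∃ R₁ y₁,
      (if y = a + 1 ∧ L.getLast? = some a then (L ++ y :: H, some (a + 1))
        else (L ++ a :: H, some y)) = (R₁, some y₁) ∧ R₁.length = (L ++ y :: H).length ∧
      R₁.Pairwise (· < ·) ∧ H.reverse ++ sweep a y L.reverse = R₁.reverse ++ [y₁] := by
    intro hLa
    have hlast : L.getLast? ≠ some a := fun h =>
      lt_irrefl a (hLa a (List.mem_of_getLast? h))
    refine ⟨L ++ a :: H, y, by simp [hlast], by simp, ?_, ?_⟩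
    · rw [List.pairwise_append, List.pairwise_cons]
      refine ⟨hLp, ⟨fun b hb => hy.trans (hyH b hb), hHp⟩, fun b hb c hc => ?_⟩
      rcases List.mem_cons.1 hc with rfl | hc
      · exact hLa b hb
      · exact hLH b hb c (by simp [hc])
    · rw [sweep_of_pairwise y (List.pairwise_cons.2 ⟨by simpa using hLa, hLr⟩)]
      simp
  rcases hLe : L.reverse with _ | ⟨b, t'⟩
  · rw [hLe] at hnormal
    exact hnormal (by simp [List.reverse_eq_nil_iff.1 hLe])
  have hLeq : L = t'.reverse ++ [b] := by rw [← List.reverse_reverse L, hLe]; simp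
  have hba : b ≤ a := hL b (by simp [hLeq])
  rw [hLe, List.pairwise_cons] at hLr
  rcases hba.lt_or_eq with hlt | rfl
  · rw [← hLe]
    refine hnormal fun c hc => ?_
    rw [← List.mem_reverse, hLe, List.mem_cons] at hc
    rcases hc with rfl | hc
    · exact hlt
    · exact (hLr.1 c hc).trans hlt
  by_cases hyb : y = b + 1
  · subst hyb
    refine ⟨L ++ (b + 1) :: H, b + 1, by simp [hLeq], rfl, ?_, ?_⟩
    · rw [List.pairwise_append, List.pairwise_cons]
      exact ⟨hLp, ⟨hyH, hHp⟩, hLH⟩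
    · rw [sweep, if_neg (lt_irrefl b), if_neg (lt_irrefl b),
        sweep_of_pairwise _ (List.pairwise_cons.2 hLr)]
      simp [hLe]
  · -- The letter `b` commutes with all letters up to `y`, which leads to a factor `b y b`.
    exfalso
    have hw : toInt (p ++ b :: ((L ++ y :: H).reverse ++ s)) =
        toInt p ++ (b : ℤ) :: (toInt H.reverse ++ (y : ℤ) :: b :: toInt (t' ++ s)) := by
      simp [hLe]
    rw [hw] at hr
    refine not_red_sandwich (toInt p ++ toInt H.reverse) (toInt (t' ++ s))
      (a := (b : ℤ)) (c := (y : ℤ)) (.inl (by omega)) (hr.of_intPerm_eq ?_ (by simp; omega))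
    have := intPerm_comm (a := (b : ℤ)) (H := toInt H.reverse) (by
      simp only [toInt, List.mem_map, List.mem_reverse]
      rintro _ ⟨c, hc, rfl⟩
      have := hyH c hc
      omega)
    simp only [intPerm_append, intPerm_cons, mul_assoc]
    rw [← mul_assoc (adjSwap _) (intPerm (toInt H.reverse)), this, mul_assoc]

/-! ### Insertion and recording tableaux of bumped words -/

/-- The reading word of a tableau: its rows from top to bottom, each from right to left. -/
def readingWord (T : List (List ℕ)) : List ℕ := T.flatMap List.reverse

/-- `T` and `T'` have the same shape, and their rows are non-empty and strictly increasing. -/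
def SameShape (T T' : List (List ℕ)) : Prop :=
  List.Forall₂ (fun R R' => R.length = R'.length ∧ (R ≠ [] ∧ R.Pairwise (· < ·)) ∧
    (R' ≠ [] ∧ R'.Pairwise (· < ·))) T T'

theorem tableauInsert_cons_none {x : ℕ} {R R₁ : List ℕ} (T : List (List ℕ))
    (h : rowInsert x R = (R₁, none)) : tableauInsert x (R :: T) = (R₁ :: T, 0) := by
  simp [tableauInsert, h]

theorem tableauInsert_cons_some {x y : ℕ} {R R₁ : List ℕ} (T : List (List ℕ))
    (h : rowInsert x R = (R₁, some y)) : tableauInsert x (R :: T) =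
      (R₁ :: (tableauInsert y T).1, (tableauInsert y T).2 + 1) := by
  simp [tableauInsert, h]

/-- A letter that exceeds the last entry of an increasing row is appended to it. -/
theorem rowInsert_of_last_lt {a h : ℕ} {R t : List ℕ} (hR : R.Pairwise (· < ·))
    (he : R.reverse = h :: t) (hha : h < a) :
    rowInsert a R = (R ++ [a], none) ∧ (R ++ [a]).Pairwise (· < ·) := by
  have hr : R.reverse.Pairwise (· > ·) := by simpa [List.pairwise_reverse] using hR
  rw [he, List.pairwise_cons] at hr
  have hlt : ∀ r ∈ R, r < a := fun r hr' => by
    rw [← List.mem_reverse, he, List.mem_cons] at hr'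
    rcases hr' with rfl | hr'
    · exact hha
    · exact (hr.1 r hr').trans hha
  refine ⟨rowInsert_of_forall_le fun r hr => (hlt r hr).le, ?_⟩
  rw [List.pairwise_append]
  exact ⟨hR, by simp, by simpa using hlt⟩

/-- Inserting a letter into the tableaux of a word and of its bump adds boxes in the same place, and
the Coxeter-Knuth moves that turn the reading words with the letter in front into the new reading
words are made at the same positions. -/
theorem BumpRel.tableauInsert {T T' : List (List ℕ)} {p p' : List ℕ} {a a' : ℕ}
    (h : BumpRel (p ++ a :: readingWord T) (p' ++ a' :: readingWord T'))
    (hp : p.length = p'.length) (hT : SameShape T T') :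
    (tableauInsert a T).2 = (LittleEG.tableauInsert a' T').2 ∧
      SameShape (LittleEG.tableauInsert a T).1 (LittleEG.tableauInsert a' T').1 ∧
      BumpRel (p ++ readingWord (LittleEG.tableauInsert a T).1)
        (p' ++ readingWord (LittleEG.tableauInsert a' T').1) := by
  induction hT generalizing p p' a a' with
  | nil => exact ⟨rfl, .cons (by simp) .nil, by simpa [readingWord, LittleEG.tableauInsert] using h⟩
  | @cons R R' T T' hRR hTT ih =>
    obtain ⟨hlen, ⟨hne, hR⟩, hne', hR'⟩ := hRR
    obtain ⟨b, t, he⟩ := List.exists_cons_of_ne_nil (mt List.reverse_eq_nil_iff.1 hne)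
    obtain ⟨b', t', he'⟩ := List.exists_cons_of_ne_nil (mt List.reverse_eq_nil_iff.1 hne')
    have hrd : ∀ (R : List ℕ) (T : List (List ℕ)),
      readingWord (R :: T) = R.reverse ++ readingWord T := fun R T => by simp [readingWord]
    have htt : t.length = t'.length := by
      have h1 := congrArg List.length he
      have h2 := congrArg List.length he'
      simp at h1 h2
      omega
    have hred := h.1
    have hred' := h.red_right
    simp only [hrd] at h hred hred'
    have hiff : a < b ↔ a' < b' := by
      rw [he, he'] at h
      exact h.lt_iff hp
    rcases lt_trichotomy a b with hab | rfl | hba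
    · obtain ⟨R₁, y, hins, hl₁, hR₁, hsw⟩ := rowInsert_eq_sweep hred hR he hab
      obtain ⟨R₁', y', hins', hl₁', hR₁', hsw'⟩ :=
        rowInsert_eq_sweep hred' hR' he' (hiff.1 hab)
      have hd : (b :: t).Pairwise (· > ·) := by
        rw [← he]; simpa [List.pairwise_reverse] using hR
      rw [he, he'] at h
      have h1 := BumpRel.sweep h hp htt hab hd
      rw [hsw, hsw'] at h1
      obtain ⟨i1, i2, i3⟩ := ih (p := p ++ R₁.reverse) (p' := p' ++ R₁'.reverse) (a := y)
        (a' := y') (by simpa using h1) (by simp; omega)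
      rw [tableauInsert_cons_some T hins, tableauInsert_cons_some T' hins']
      refine ⟨by simpa using i1, .cons ⟨by omega, ⟨?_, hR₁⟩, ?_, hR₁'⟩ i2,
        by simpa [hrd] using i3⟩
      · rintro rfl; simp at hl₁; exact hne (List.length_eq_zero_iff.1 hl₁.symm)
      · rintro rfl; simp at hl₁'; exact hne' (List.length_eq_zero_iff.1 hl₁'.symm)
    · rw [he] at hred
      simp only [toInt_append, toInt_cons, List.cons_append] at hred
      exact absurd hred (not_red_pair _ _ _)
    · have hba' : b' < a' := by
        rcases lt_trichotomy a' b' with h' | rfl | h'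
        · have := hiff.2 h'; omega
        · rw [he'] at hred'
          simp only [toInt_append, toInt_cons, List.cons_append] at hred'
          exact absurd hred' (not_red_pair _ _ _)
        · exact h'
      obtain ⟨hins, hs⟩ := rowInsert_of_last_lt hR he hba
      obtain ⟨hins', hs'⟩ := rowInsert_of_last_lt hR' he' hba'
      rw [tableauInsert_cons_none T hins, tableauInsert_cons_none T' hins']
      exact ⟨rfl, .cons ⟨by simp [hlen], ⟨by simp, hs⟩, by simp, hs'⟩ hTT,
        by simpa [hrd] using h⟩

/-- The suffixes `u` and `u'` at the same positions of a word and of its bump have the same recording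
tableau; the first word with `u` replaced by the reading word of its insertion tableau is still
related by a bump to the second word with `u'` replaced likewise. -/
theorem BumpRel.recordingTableau_eq_aux {u u' p p' : List ℕ} (h : BumpRel (p ++ u) (p' ++ u'))
    (hp : p.length = p'.length) (hu : u.length = u'.length) :
    recordingTableau u = recordingTableau u' ∧
      SameShape (insertionTableau u) (insertionTableau u') ∧
      BumpRel (p ++ readingWord (insertionTableau u)) (p' ++ readingWord (insertionTableau u')) := by
  induction u generalizing u' p p' with
  | nil =>
    obtain rfl := List.eq_nil_of_length_eq_zero hu.symm
    exact ⟨rfl, .nil, h⟩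
  | cons a u ih =>
    obtain _ | ⟨a', u'⟩ := u'
    · simp at hu
    have hu' : u.length = u'.length := by simpa using hu
    obtain ⟨i1, i2, i3⟩ := ih (p := p ++ [a]) (p' := p' ++ [a']) (u' := u') (by simpa using h)
      (by simp [hp]) hu'
    obtain ⟨j1, j2, j3⟩ := BumpRel.tableauInsert (p := p) (p' := p') (a := a) (a' := a')
      (by simpa using i3) hp i2
    exact ⟨by rw [recordingTableau, recordingTableau, i1, j1, hu'], j2, j3⟩

theorem BumpRel.recordingTableau_eq {w w' : List ℕ} (h : BumpRel w w') :
    recordingTableau w = recordingTableau w' := by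
  refine (BumpRel.recordingTableau_eq_aux (p := []) (p' := []) h rfl ?_).1
  obtain ⟨-, c, i, n, -, -, hb⟩ := h
  simpa using hb.length_eq.symm

/-! ### Little bumps as bumps of integer words -/

theorem intPerm_toInt_natCast (w : List ℕ) (n : ℕ) :
    intPerm (toInt w) (n : ℤ) = (wordPerm w n : ℕ) := by
  induction w with
  | nil => rfl
  | cons a w ih =>
    have hw : wordPerm (a :: w) n = Equiv.swap a (a + 1) (wordPerm w n) := by simp [wordPerm]
    rw [hw, toInt_cons, intPerm_cons, Equiv.Perm.mul_apply, ih, adjSwap, Equiv.swap_apply_def,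
      Equiv.swap_apply_def]
    split_ifs <;> omega

theorem intPerm_toInt_eq_iff {v w : List ℕ} :
    intPerm (toInt v) = intPerm (toInt w) ↔ wordPerm v = wordPerm w := by
  constructor
  · intro h
    ext n
    have := congrArg (· (n : ℤ)) h
    simpa [intPerm_toInt_natCast] using this
  · intro h
    ext x
    rcases lt_or_ge x 0 with hx | hx
    · have hnonneg : ∀ u : List ℕ, ∀ a ∈ toInt u, (0 : ℤ) ≤ a := fun u a ha => by
        simp only [toInt, List.mem_map] at ha
        obtain ⟨b, -, rfl⟩ := ha
        omega
      rw [intPerm_apply_of_lt (hnonneg v) hx, intPerm_apply_of_lt (hnonneg w) hx]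
    · obtain ⟨n, rfl⟩ := Int.eq_ofNat_of_zero_le hx
      rw [intPerm_toInt_natCast, intPerm_toInt_natCast, h]

/-- For positive words it does not matter whether shorter words may have letters in `ℤ`: by the
deletion property a word that is not reduced is longer than one of its own subwords with the same
permutation. -/
theorem isReducedWord_iff {w : List ℕ} : IsReducedWord w ↔ IsWord w ∧ Red (toInt w) := by
  refine ⟨fun h => ⟨h.1, ?_⟩, fun h => ⟨h.1, fun v _ hv => ?_⟩⟩
  · by_contra hn
    obtain ⟨i, hi, j, hj, hc⟩ := exists_crossing_eq_of_not_red hn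
    have hp := intPerm_eraseIdx_eraseIdx hi hj hc
    rw [← toInt_eraseIdx, ← toInt_eraseIdx, intPerm_toInt_eq_iff] at hp
    have := h.2 _ (fun a ha => h.1 a (List.mem_of_mem_eraseIdx (List.mem_of_mem_eraseIdx ha))) hp
    rw [length_toInt] at hi
    have h1 := List.length_eraseIdx_of_lt hi
    rw [List.length_eraseIdx_of_lt (by omega)] at this
    omega
  · simpa using h.2 (toInt v) (intPerm_toInt_eq_iff.2 hv)

theorem swap_eq_swap_iff {a b c d : ℤ} (h : a ≠ b) :
    Equiv.swap a b = Equiv.swap c d ↔ s(a, b) = s(c, d) := by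
  rw [Sym2.eq_iff]
  constructor
  · intro he
    have h1 : Equiv.swap c d a = b := by rw [← he, Equiv.swap_apply_left]
    rw [Equiv.swap_apply_def] at h1
    split_ifs at h1 <;> tauto
  · rintro (⟨rfl, rfl⟩ | ⟨rfl, rfl⟩)
    · rfl
    · exact Equiv.swap_comm _ _

theorem swappedValues_eq_iff (w : List ℕ) (i j : ℕ) :
    swappedValues w i = swappedValues w j ↔ crossing (toInt w) i = crossing (toInt w) j := by
  have hc : ∀ i, crossing (toInt w) i =
      Equiv.swap ((wordPerm (w.take i) (w.getD i 0) : ℕ) : ℤ)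
        ((wordPerm (w.take i) (w.getD i 0 + 1) : ℕ) : ℤ) := by
    intro i
    have h1 : (toInt w).take i = toInt (w.take i) := by simp [toInt, List.map_take]
    have h2 : (toInt w).getD i 0 = ((w.getD i 0 : ℕ) : ℤ) := by
      simp only [toInt, List.getD_eq_getElem?_getD, List.getElem?_map]
      cases w[i]? <;> simp
    rw [crossing, h1, h2, adjSwap, ← Equiv.swap_apply_apply, intPerm_toInt_natCast,
      ← intPerm_toInt_natCast (w.take i) (w.getD i 0 + 1)]
    push_cast
    rfl
  have hne : ((wordPerm (w.take i) (w.getD i 0) : ℕ) : ℤ) ≠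
      ((wordPerm (w.take i) (w.getD i 0 + 1) : ℕ) : ℤ) := fun h => by
    have := (wordPerm (w.take i)).injective (Nat.cast_injective h)
    omega
  rw [hc, hc, swap_eq_swap_iff hne, swappedValues, swappedValues, Sym2.eq_iff, Sym2.eq_iff]
  norm_cast

theorem IsWord.decrementAt {w : List ℕ} (hw : IsWord w) (i : ℕ) : IsWord (decrementAt w i) := by
  intro a ha
  unfold LittleEG.decrementAt at ha
  split_ifs at ha with h1
  · rcases List.mem_or_eq_of_mem_set ha with h | rfl
    · simp only [List.mem_map] at h
      obtain ⟨b, -, rfl⟩ := h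
      omega
    · exact le_rfl
  · obtain ⟨k, hk⟩ := List.mem_iff_getElem?.1 ha
    rw [List.getElem?_modify] at hk
    obtain ⟨b, hb, rfl⟩ : ∃ b, w[k]? = some b ∧ (if i = k then b - 1 else b) = a := by
      simpa [Option.map_eq_some_iff] using hk
    have hb1 := hw b (List.mem_of_getElem? hb)
    split_ifs with hik
    · subst hik
      have : b ≠ 1 := fun h => h1 (h ▸ hb)
      omega
    · exact hb1

@[simp] theorem length_decrementAt (w : List ℕ) (i : ℕ) :
    (decrementAt w i).length = w.length := by
  unfold decrementAt
  split_ifs <;> simp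

/-- Up to a translation, `decrementAt` decrements the letter at the given position, also if this
letter is `1`. -/
theorem exists_toInt_decrementAt {w : List ℕ} (hw : IsWord w) (i : ℕ) :
    ∃ c : ℤ, toInt (decrementAt w i) = shift c (dec (toInt w) i) := by
  unfold decrementAt
  split_ifs with h1
  · refine ⟨1, List.ext_getElem? fun k => ?_⟩
    simp only [toInt, shift, dec, List.getElem?_map, List.getElem?_set, List.getElem?_modify,
      List.length_map]
    have hi : i < w.length := (List.getElem?_eq_some_iff.1 h1).1
    by_cases hik : i = k
    · subst hik
      rw [h1]
      simp [hi]
    · cases w[k]? <;> simp [hik]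
  · refine ⟨0, List.ext_getElem? fun k => ?_⟩
    simp only [toInt, shift, dec, List.getElem?_map, List.getElem?_modify]
    rcases hk : w[k]? with _ | b
    · simp
    · have hb := hw b (List.mem_of_getElem? hk)
      by_cases hik : i = k <;> simp [hik, hb]

theorem red_toInt_decrementAt_iff {w : List ℕ} (hw : IsWord w) (i : ℕ) :
    IsReducedWord (decrementAt w i) ↔ Red (dec (toInt w) i) := by
  obtain ⟨c, hc⟩ := exists_toInt_decrementAt hw i
  rw [isReducedWord_iff, hc, red_shift_iff, and_iff_right (hw.decrementAt i)]

theorem swappedValues_decrementAt_iff {w : List ℕ} (hw : IsWord w) {i j : ℕ} (hi : i < w.length)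
    (hj : j < w.length) :
    swappedValues (decrementAt w i) j = swappedValues (decrementAt w i) i ↔
      crossing (dec (toInt w) i) j = crossing (dec (toInt w) i) i := by
  obtain ⟨c, hc⟩ := exists_toInt_decrementAt hw i
  rw [swappedValues_eq_iff, hc, crossing_shift_eq_iff c (by simpa) (by simpa)]

theorem BumpsTo.exists_bump {w v : List ℕ} {i : ℕ} (h : BumpsTo w i v) (hw : IsWord w)
    (hi : i < w.length) : ∃ c n, Bump n (dec (toInt w) i) i (shift c (toInt v)) := by
  induction h with
  | last w i h =>
    obtain ⟨c, hc⟩ := exists_toInt_decrementAt hw i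
    refine ⟨-c, 0, ?_⟩
    rw [hc, shift_neg_shift]
    exact .done _ _ ((red_toInt_decrementAt_iff hw i).1 h)
  | next w i j v h hj hij hs hv ih =>
    obtain ⟨c, hc⟩ := exists_toInt_decrementAt hw i
    obtain ⟨d, n, hb⟩ := ih (hw.decrementAt i) (by simpa)
    rw [hc, dec_shift] at hb
    have hb' := hb.shift (by simpa) (-c)
    rw [shift_neg_shift, shift_shift] at hb'
    exact ⟨d + -c, n + 1, .next n _ i j _ (by rwa [← red_toInt_decrementAt_iff hw])
      (by simpa) hij ((swappedValues_decrementAt_iff hw hi hj).1 hs) hb'⟩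

theorem exists_bumpsTo_of_bump {n : ℕ} {w : List ℕ} {i : ℕ} {z : List ℤ} (hw : IsWord w)
    (hi : i < w.length) (h : Bump n (dec (toInt w) i) i z) : ∃ v, BumpsTo w i v := by
  induction n generalizing w i z with
  | zero =>
    cases h with
    | done _ _ h => exact ⟨_, .last w i ((red_toInt_decrementAt_iff hw i).2 h)⟩
  | succ n ih =>
    cases h with
    | next _ _ _ j _ hn hj hij hc hv =>
      have hj' : j < w.length := by simpa using hj
      obtain ⟨c, hc'⟩ := exists_toInt_decrementAt hw i
      have hv' := hv.shift (by simpa) c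
      rw [← dec_shift, ← hc'] at hv'
      obtain ⟨v, hb⟩ := ih (hw.decrementAt i) (by simpa) hv'
      exact ⟨v, .next w i j v (by rwa [red_toInt_decrementAt_iff hw]) hj' hij
        ((swappedValues_decrementAt_iff hw hi hj').2 hc) hb⟩

theorem BumpsTo.unique {w v v' : List ℕ} {i : ℕ} (h : BumpsTo w i v) (h' : BumpsTo w i v')
    (hw : IsWord w) (hi : i < w.length) (hr : Red ((toInt w).eraseIdx i)) : v = v' := by
  induction h with
  | last w i h =>
    cases h' with
    | last => rfl
    | next _ _ _ _ hn => exact absurd h hn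
  | next w i j v hn hj hij hs hv ih =>
    cases h' with
    | last _ _ h => exact absurd h hn
    | next _ _ k _ _ hk hik hs' hv' =>
      have hcj := (swappedValues_decrementAt_iff hw hi hj).1 hs
      have hck := (swappedValues_decrementAt_iff hw hi hk).1 hs'
      rw [← eraseIdx_dec] at hr
      obtain rfl := conflict_unique (by simpa) hr (by simpa) hij hcj (by simpa) hik hck
      refine ih hv' (hw.decrementAt i) (by simpa) ?_
      obtain ⟨c, hc⟩ := exists_toInt_decrementAt hw i
      rw [hc, eraseIdx_shift, red_shift_iff]
      exact Red.eraseIdx_congr (by simpa) hr (by simpa) hcj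

end LittleEG

theorem mainTheorem3 (w : List ℕ) (hw : LittleEG.IsReducedWord w)
    (i : ℕ) (hi : i < w.length) (hwi : LittleEG.IsReducedWord (w.eraseIdx i)) :
    (∃! v : List ℕ, LittleEG.BumpsTo w i v) ∧
      ∀ v : List ℕ, LittleEG.BumpsTo w i v →
        LittleEG.recordingTableau w = LittleEG.recordingTableau v := by
  have hr := (LittleEG.isReducedWord_iff.1 hwi).2
  rw [LittleEG.toInt_eraseIdx] at hr
  obtain ⟨n, z, hz⟩ := LittleEG.exists_bump (u := LittleEG.dec (LittleEG.toInt w) i) (i := i)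
    (by simpa) (by rwa [LittleEG.eraseIdx_dec])
  obtain ⟨v, hv⟩ := LittleEG.exists_bumpsTo_of_bump hw.1 hi hz
  refine ⟨⟨v, hv, fun v' hv' => hv'.unique hv hw.1 hi hr⟩, fun v' hv' => ?_⟩
  obtain ⟨c, m, hb⟩ := hv'.exists_bump hw.1 hi
  exact LittleEG.BumpRel.recordingTableau_eq
    ⟨(LittleEG.isReducedWord_iff.1 hw).2, c, i, m, hi, hr, hb⟩
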